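/- Let $\vec{\mathbb T}=(\mathbb V,\vec{\mathbb E})$ be a directed tree with countable vertex set, that is, an orientation of an undirected tree in which every vertex $x$ has exactly one parent $p(x)$ and at least one child; a directed edge $xy\in\vec{\mathbb E}$ goes from the child $x$ to its parent $y=p(x)$. A function $h:\mathbb V\to\mathbb Z$ is *monotone* if $h(y)-h(x)\ge 0$ for all $xy\in\vec{\mathbb E}$. For finite $\Lambda\subset\mathbb V$ and monotone $b$, let $\gamma_\Lambda(\cdot,b)$ be the uniform probability measure on the finite set of monotone $h$ with $h=b$ on $\mathbb V\setminus\Lambda$. Let $\mathcal F^\nabla$ be the sigma-algebra on $\Omega=\mathbb Z^{\mathbb V}$ generated by all differences $h(y)-h(x)$, $x,y\in\mathbb V$, let $\mathcal T_\Lambda$ be the sigma-algebra generated by the heights $h(x)$, $x\in\mathbb V\setminus\Lambda$, and let $\mathcal T^\nabla=\mathcal F^\nabla\cap\bigcap_{\Lambda\text{ finite}}\mathcal T_\Lambda$. A *gradient Gibbs measure* is a probability measure $\mu$ on $(\Omega,\mathcal F^\nabla)$ that is supported on monotone functions and satisfies $\mu\gamma_\Lambda=\mu$, i.e. $\int\gamma_\Lambda(A,b)\,d\mu(b)=\mu(A)$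 for all $A\in\mathcal F^\nabla$, for every finite $\Lambda\subset\mathbb V$. It is *extremal* if $\mu(A)\in\{0,1\}$ for all $A\in\mathcal T^\nabla$. A *flow* is a map $\phi:\vec{\mathbb E}\to(0,\infty]$ such that $\phi_{xp(x)}=\sum_{y:\,yx\in\vec{\mathbb E}}\phi_{yx}$ for all $x\in\mathbb V$. For $\alpha\in(0,\infty]$, let $\mathrm{Geom}(\alpha)$ be the distribution on $\mathbb Z_{\ge 0}$ that gives $k$ a probability proportional to $e^{-k\alpha}$ (for $\alpha=\infty$, the point mass at $0$). **Theorem.** For every flow $\phi$ there is exactly one probability measure $\mu_\phi$ on $(\Omega,\mathcal F^\nabla)$ under which the increments $(h(y)-h(x))_{xy\in\vec{\mathbb E}}$ are independent with $h(y)-h(x)\sim\mathrm{Geom}(\phi_{xy})$. This measure is an extremal gradient Gibbs measure, and the map $\phi\mapsto\mu_\phi$ is a bijection from the set of flows to the set of extremal gradient Gibbs measures. -/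

import Mathlib

open MeasureTheory ProbabilityTheory
open scoped ENNReal

/-- A directed tree on the vertex set `V`, in which every vertex has exactly one parent and at
least one child. `Arc x y` means that `xy` is a directed edge, with `x` the child and `y` the
parent. The asymmetry excludes loops and pairs of opposite edges, so that the directed edges are
the edges of the underlying undirected tree, each with one orientation. -/
structure DirectedTree (V : Type*) where
  Arc : V → V → Prop
  asymm : ∀ x y, Arc x y → ¬ Arc y x
  isTree : (SimpleGraph.fromRel Arc).IsTree
  existsUnique_parent : ∀ x, ∃! y, Arc x y
  exists_child : ∀ y, ∃ x, Arc x y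

/-- The gradient sigma-algebra on height functions: the smallest one that makes all the height
differences `h y - h x` measurable. -/
@[reducible] def gradSigma (V : Type*) : MeasurableSpace (V → ℤ) :=
  ⨆ (x : V) (y : V), MeasurableSpace.comap (fun h : V → ℤ => h y - h x) ⊤

/-- The sigma-algebra generated by the heights `h x` at the vertices `x` outside `Λ`. -/
@[reducible] def outsideSigma {V : Type*} (Λ : Finset V) : MeasurableSpace (V → ℤ) :=
  ⨆ (x : V) (_ : x ∉ Λ), MeasurableSpace.comap (fun h : V → ℤ => h x) ⊤

/-- The tail sigma-algebra. -/
@[reducible] def tailSigma (V : Type*) : MeasurableSpace (V → ℤ) :=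
  ⨅ Λ : Finset V, outsideSigma Λ

/-- The gradient tail sigma-algebra: the events that are both tail events and gradient events. -/
@[reducible] def gradTailSigma (V : Type*) : MeasurableSpace (V → ℤ) :=
  tailSigma V ⊓ gradSigma V

/-- The weight `e ^ (-k α)` for `α ∈ [0, ∞]`. For `α = ∞` it is `1` at `k = 0` and `0` at
`k ≥ 1`. -/
noncomputable def geomWeight (α : ℝ≥0∞) (k : ℕ) : ℝ≥0∞ :=
  EReal.exp (-(((k : ℝ≥0∞) * α : ℝ≥0∞) : EReal))

/-- The distribution `Geom(α)` for `α ∈ (0, ∞]`, as a measure on `ℤ` carried by the nonnegative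
integers: the probability of `k` is proportional to `e ^ (-k α)`. -/
noncomputable def geomDist (α : ℝ≥0∞) : Measure ℤ :=
  (∑' k, geomWeight α k)⁻¹ •
    Measure.sum (fun k : ℕ => geomWeight α k • Measure.dirac (k : ℤ))

namespace DirectedTree

variable {V : Type*} (T : DirectedTree V)

/-- The set of directed edges. -/
abbrev Edge : Type _ := {e : V × V // T.Arc e.1 e.2}

/-- The parent of a vertex. -/
noncomputable def parent (x : V) : V := (T.existsUnique_parent x).choose

theorem arc_parent (x : V) : T.Arc x (T.parent x) :=
  (T.existsUnique_parent x).choose_spec.1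

/-- The edge from a vertex to its parent. -/
noncomputable def parentEdge (x : V) : T.Edge := ⟨(x, T.parent x), T.arc_parent x⟩

/-- The edge from a child `y` of `x` to `x`. -/
def childEdge (x : V) (y : {y : V // T.Arc y x}) : T.Edge := ⟨(y.1, x), y.2⟩

/-- The set of monotone integer functions. -/
def monotoneFunctions : Set (V → ℤ) := {f | ∀ x y, T.Arc x y → 0 ≤ f y - f x}

/-- The monotone functions that agree with `b` outside `Λ`. -/
def extensions (Λ : Finset V) (b : V → ℤ) : Set (V → ℤ) :=
  {h | h ∈ T.monotoneFunctions ∧ ∀ x, x ∉ Λ → h x = b x}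

/-- The local Gibbs measure in `Λ` with boundary height function `b`: the uniform probability
measure on the (finite) set of monotone functions that agree with `b` outside `Λ`. It lives on
the product sigma-algebra and is meant for monotone `b`. -/
noncomputable def localGibbs (Λ : Finset V) (b : V → ℤ) : Measure (V → ℤ) :=
  uniformOn (T.extensions Λ b)

/-- Gradient Gibbs measures: probability measures on the gradient sigma-algebra that are supported
on the monotone functions and satisfy the Dobrushin-Lanford-Ruelle equations `μ γ_Λ = μ` for all
finite `Λ`. -/
structure IsGradientGibbs (μ : @Measure (V → ℤ) (gradSigma V)) : Prop where
  isProbabilityMeasure : IsProbabilityMeasure μ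
  supported : ∀ᵐ h ∂μ, h ∈ T.monotoneFunctions
  dlr : ∀ (Λ : Finset V) (A : Set (V → ℤ)), MeasurableSet[gradSigma V] A →
    ∫⁻ b, T.localGibbs Λ b A ∂μ = μ A

/-- Extremal gradient Gibbs measures: those that are trivial on the gradient tail
sigma-algebra. -/
structure IsExtremalGradientGibbs (μ : @Measure (V → ℤ) (gradSigma V)) : Prop where
  isGradientGibbs : T.IsGradientGibbs μ
  tailTrivial : ∀ A : Set (V → ℤ), MeasurableSet[gradTailSigma V] A → μ A = 0 ∨ μ A = 1

/-- The set of extremal gradient Gibbs measures, as a type. -/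
abbrev ExtremalGradientGibbs : Type _ :=
  {μ : @Measure (V → ℤ) (gradSigma V) // T.IsExtremalGradientGibbs μ}

/-- A flow: a function on the directed edges with values in `(0, ∞]` such that, at each vertex, the
value on the edge to the parent is the sum of the values on the edges from the children. -/
structure IsFlow (φ : T.Edge → ℝ≥0∞) : Prop where
  pos : ∀ e, 0 < φ e
  conservation : ∀ x, φ (T.parentEdge x) = ∑' y, φ (T.childEdge x y)

/-- The set of flows, as a type. -/
abbrev Flow : Type _ := {φ : T.Edge → ℝ≥0∞ // T.IsFlow φ}

/-- `μ` is the flow measure `μ_φ`: a probability measure on the gradient sigma-algebra under which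
the increments `h y - h x` along the directed edges `xy` are independent, with distribution
`Geom(φ xy)`. -/
structure IsFlowMeasure (φ : T.Edge → ℝ≥0∞) (μ : @Measure (V → ℤ) (gradSigma V)) : Prop where
  isProbabilityMeasure : IsProbabilityMeasure μ
  indep : iIndepFun (fun (e : T.Edge) (h : V → ℤ) => h e.1.2 - h e.1.1) μ
  law : ∀ e : T.Edge,
    @Measure.map (V → ℤ) ℤ (gradSigma V) _ (fun h => h e.1.2 - h e.1.1) μ = geomDist (φ e)

end DirectedTree

/-! ### Genealogy: ancestral lines and descending lines. -/

namespace DirectedTree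

variable {V : Type*} (T : DirectedTree V)

/-! Put `ω v = h (p v) - h v`. A gradient measure becomes a law `P` of `ω`, and the DLR equations
say that `P` lives on `0 ≤ ω` and is invariant under `ω ↦ ω + T.increments g`, for finitely
supported `g`, wherever both ends are nonnegative (`isGradientGibbs_iff`). Gradient tail events
become the sets invariant under these translations (`measurableSet_gradTailSigma_iff`).

Extremal measures are products. Raising the heights by one on a large finite set of descendants of
`v`, with `v` included, lowers `ω v` by one and otherwise changes only increments far below `v`.
Hence `P` restricted to `1 ≤ ω v` is at most the image of `P` under `raise {v}`
(`restrict_le_map_raise`). Both measures have the same translation invariance, so tail triviality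
makes them proportional (`restrict_eq_smul_map_raise`). This scaling relation says that `ω v` is
geometric and independent of the other coordinates, so `P = geomProduct φ` (`eq_smul_geomProduct`).
Raising the height at `z` alone trades `1 ≤ ω z` for `1 ≤ ω v` at all children `v` of `z`, so `e ^
(-φ z)` is the product of the `e ^ (-φ v)`: this is conservation.

Conversely, for a flow the same identity makes the product invariant under height changes at one
vertex, and these generate all others (`preservesShift_of_single`). If `C` is local-invariant, then
`P.restrict C` is again Gibbs; the domination for `C` and its complement gives `raise {v} ⁻¹' C = C`
almost surely when the ratio at `v` is nonzero. So `P.restrict C` scales like `P`, equals `P C • P`,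
and `P C = P C * P C`. -/

theorem arc_iff {x y : V} : T.Arc x y ↔ y = T.parent x :=
  ⟨fun h => (T.existsUnique_parent x).unique h (T.arc_parent x), fun h => h ▸ T.arc_parent x⟩

theorem parent_surjective : Function.Surjective T.parent := fun y =>
  (T.exists_child y).imp fun _ h => (T.arc_iff.1 h).symm

theorem parent_ne (x : V) : T.parent x ≠ x := fun h =>
  T.asymm x x (T.arc_iff.2 h.symm) (T.arc_iff.2 h.symm)

theorem parent_parent_ne (x : V) : T.parent (T.parent x) ≠ x := fun h =>
  T.asymm x (T.parent x) (T.arc_parent x) (T.arc_iff.2 h.symm)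

theorem adj_parent (x : V) : (SimpleGraph.fromRel T.Arc).Adj x (T.parent x) := by
  rw [SimpleGraph.fromRel_adj]
  exact ⟨(T.parent_ne x).symm, Or.inl (T.arc_parent x)⟩

/-- A period would close a cycle: every edge of a tree is a bridge, yet up to the minimal period the
ancestral line leads from `T.parent x` back to `x` without the edge between them. -/
theorem iterate_parent_ne {k : ℕ} (hk : 0 < k) (x : V) : T.parent^[k] x ≠ x := by
  classical
  intro h
  have hex : ∃ k, 0 < k ∧ T.parent^[k] x = x := ⟨k, hk, h⟩
  obtain ⟨hm, hmx⟩ := Nat.find_spec hex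
  have hmin := fun j => Nat.find_min (m := j) hex
  set m := Nat.find hex
  have hbr := SimpleGraph.isAcyclic_iff_forall_adj_isBridge.1 T.isTree.isAcyclic (T.adj_parent x)
  rw [SimpleGraph.isBridge_iff] at hbr
  apply hbr
  have key : ∀ j, 1 ≤ j → j ≤ m →
      ((SimpleGraph.fromRel T.Arc).deleteEdges {s(x, T.parent x)}).Reachable
        (T.parent x) (T.parent^[j] x) := by
    intro j hj
    induction j, hj using Nat.le_induction with
    | base => intro _; exact SimpleGraph.Reachable.refl _
    | succ j hj ih =>
      intro hjm
      refine (ih (by omega)).trans (SimpleGraph.Adj.reachable ?_)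
      rw [Function.iterate_succ_apply', SimpleGraph.deleteEdges_adj]
      refine ⟨T.adj_parent _, ?_⟩
      have hne : T.parent^[j] x ≠ x := fun h' => hmin j (by omega) ⟨by omega, h'⟩
      -- The line could reuse the deleted edge only by starting at `x`, against minimality, or
      -- backwards, making `x` its own grandparent.
      simp only [Set.mem_singleton_iff, Sym2.eq_iff, not_or, not_and]
      refine ⟨fun h' => absurd h' hne, fun h1 h2 => ?_⟩
      rw [h1] at h2
      exact T.parent_parent_ne x h2
  have := key m hm le_rfl
  rw [hmx] at this
  exact this.symm

theorem iterate_parent_injective (x : V) : Function.Injective fun k => T.parent^[k] x := by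
  intro i j hij
  by_contra hne
  wlog hlt : i < j generalizing i j
  · exact this hij.symm (Ne.symm hne) (by omega)
  refine T.iterate_parent_ne (k := j - i) (by omega) (T.parent^[i] x) ?_
  rw [← Function.iterate_add_apply, show j - i + i = j by omega]
  exact hij.symm

theorem exists_common_ancestor (x y : V) : ∃ m n, T.parent^[m] x = T.parent^[n] y := by
  have h := (SimpleGraph.reachable_iff_reflTransGen x y).1 (T.isTree.connected.preconnected x y)
  induction h with
  | refl => exact ⟨0, 0, rfl⟩
  | @tail y z _ hyz ih =>
    obtain ⟨m, n, h⟩ := ih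
    rw [SimpleGraph.fromRel_adj, T.arc_iff, T.arc_iff] at hyz
    rcases hyz.2 with rfl | rfl
    · exact ⟨m + 1, n, by rw [Function.iterate_succ_apply', h,
        ← Function.iterate_succ_apply' T.parent, Function.iterate_succ_apply]⟩
    · exact ⟨m, n + 1, by rw [h, Function.iterate_succ_apply]⟩

theorem exists_iterate_parent_notMem (Λ : Finset V) (x : V) : ∃ k, T.parent^[k] x ∉ Λ := by
  by_contra! h
  exact Set.infinite_of_injective_forall_mem (T.iterate_parent_injective x) h Λ.finite_toSet

/-- Choosing a child of every vertex gives a descending line, which never repeats because ancestral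
lines have no period. -/
theorem exists_descendant_notMem (Λ : Finset V) (x : V) : ∃ k y, T.parent^[k] y = x ∧ y ∉ Λ := by
  obtain ⟨c, hc⟩ := T.parent_surjective.hasRightInverse
  have hck : ∀ k, T.parent^[k] (c^[k] x) = x := fun k => hc.iterate k x
  by_contra! h
  refine Set.infinite_of_injective_forall_mem (f := fun k => c^[k] x) ?_
    (fun k => h k _ (hck k)) Λ.finite_toSet
  intro i j hij
  by_contra hne
  wlog hlt : i < j generalizing i j
  · exact this hij.symm (Ne.symm hne) (by omega)
  refine T.iterate_parent_ne (k := j - i) (by omega) x ?_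
  have := hck j
  rw [show j = (j - i) + i by omega, Function.iterate_add_apply, ← show j = (j - i) + i by omega]
    at this
  rw [← show c^[i] x = c^[j] x from hij, hck i] at this
  exact this

/-! ### Increments, and heights recovered from them. -/

/-- The increments of a height function along the edges to the parents. -/
noncomputable def increments : (V → ℤ) →+ (V → ℤ) where
  toFun h v := h (T.parent v) - h v
  map_zero' := by ext; simp
  map_add' f g := by ext; simp; ring

theorem increments_apply (h : V → ℤ) (v : V) : T.increments h v = h (T.parent v) - h v := rfl

theorem mem_monotoneFunctions {h : V → ℤ} : h ∈ T.monotoneFunctions ↔ 0 ≤ T.increments h := by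
  simp only [monotoneFunctions, Set.mem_ofPred_eq, T.arc_iff, Pi.le_def, increments_apply,
    Pi.zero_apply]
  exact ⟨fun H v => H v _ rfl, fun H x y hy => hy ▸ H x⟩

/-- The sum of `ω` over the first `k` vertices of the ancestral line of `x`. -/
noncomputable def ancestralSum (k : ℕ) (x : V) (ω : V → ℤ) : ℤ :=
  ∑ i ∈ Finset.range k, ω (T.parent^[i] x)

theorem ancestralSum_increments (k : ℕ) (x : V) (h : V → ℤ) :
    T.ancestralSum k x (T.increments h) = h (T.parent^[k] x) - h x := by
  simp only [ancestralSum, increments_apply, ← Function.iterate_succ_apply']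
  exact Finset.sum_range_sub (fun i => h (T.parent^[i] x)) k

theorem ancestralSum_add (j k : ℕ) (x : V) (ω : V → ℤ) :
    T.ancestralSum (j + k) x ω = T.ancestralSum j x ω + T.ancestralSum k (T.parent^[j] x) ω := by
  simp only [ancestralSum, ← Function.iterate_add_apply]
  rw [Finset.sum_range_add]
  simp only [add_comm j]

theorem ancestralSum_nonneg {ω : V → ℤ} (hω : 0 ≤ ω) (k : ℕ) (x : V) :
    0 ≤ T.ancestralSum k x ω :=
  Finset.sum_nonneg fun _ _ => hω _

/-- This makes `height` independent of the chosen common ancestor: moving to a higher one adds the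
same sum on both sides. -/
theorem ancestralSum_sub_eq {x y : V} {m n m' n' : ℕ} (h : T.parent^[m] x = T.parent^[n] y)
    (h' : T.parent^[m'] x = T.parent^[n'] y) (ω : V → ℤ) :
    T.ancestralSum n y ω - T.ancestralSum m x ω = T.ancestralSum n' y ω - T.ancestralSum m' x ω := by
  wlog hle : m ≤ m' generalizing m m' n n'
  · exact (this h' h (by omega)).symm
  obtain ⟨j, rfl⟩ := Nat.exists_eq_add_of_le hle
  have hn : n' = n + j := by
    apply T.iterate_parent_injective y
    change T.parent^[n'] y = T.parent^[n + j] y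
    rw [← h', add_comm m, add_comm n, Function.iterate_add_apply, Function.iterate_add_apply, h]
  subst hn
  rw [T.ancestralSum_add, T.ancestralSum_add, h]
  ring

/-- A reference vertex. -/
noncomputable def root : V := T.isTree.connected.nonempty.some

/-- A height function with given increments. -/
noncomputable def height (ω : V → ℤ) (x : V) : ℤ :=
  T.ancestralSum (T.exists_common_ancestor x T.root).choose_spec.choose T.root ω -
    T.ancestralSum (T.exists_common_ancestor x T.root).choose x ω

theorem height_eq {x : V} {m n : ℕ} (h : T.parent^[m] x = T.parent^[n] T.root) (ω : V → ℤ) :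
    T.height ω x = T.ancestralSum n T.root ω - T.ancestralSum m x ω :=
  T.ancestralSum_sub_eq (T.exists_common_ancestor x T.root).choose_spec.choose_spec h ω

theorem increments_height (ω : V → ℤ) : T.increments (T.height ω) = ω := by
  ext x
  obtain ⟨m, n, h⟩ := T.exists_common_ancestor (T.parent x) T.root
  have h' : T.parent^[1 + m] x = T.parent^[n] T.root := by
    rw [add_comm, Function.iterate_succ_apply, h]
  rw [increments_apply, T.height_eq h, T.height_eq h', T.ancestralSum_add 1]
  simp [ancestralSum]

theorem exists_forall_sub_eq_ancestralSum (x y : V) : ∃ m n, ∀ h : V → ℤ,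
    h y - h x = T.ancestralSum m x (T.increments h) - T.ancestralSum n y (T.increments h) := by
  obtain ⟨m, n, hmn⟩ := T.exists_common_ancestor x y
  refine ⟨m, n, fun h => ?_⟩
  rw [T.ancestralSum_increments, T.ancestralSum_increments, hmn]
  ring

theorem measurable_ancestralSum (k : ℕ) (x : V) : Measurable (T.ancestralSum k x) := by
  unfold ancestralSum
  fun_prop

/-- A common ancestor turns each height difference into a difference of two finite sums of
increments. Gradient events are thus exactly preimages of product-measurable sets. -/
theorem gradSigma_eq_comap : gradSigma V = MeasurableSpace.pi.comap T.increments := by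
  apply le_antisymm
  · refine iSup_le fun x => iSup_le fun y => ?_
    obtain ⟨m, n, h⟩ := T.exists_forall_sub_eq_ancestralSum x y
    rw [show (fun h : V → ℤ => h y - h x) =
      (fun ω => T.ancestralSum m x ω - T.ancestralSum n y ω) ∘ T.increments from funext h,
      ← MeasurableSpace.comap_comp]
    exact MeasurableSpace.comap_mono
      ((T.measurable_ancestralSum m x).sub (T.measurable_ancestralSum n y)).comap_le
  · rw [MeasurableSpace.pi, MeasurableSpace.comap_iSup]
    refine iSup_le fun x => ?_
    rw [MeasurableSpace.comap_comp]
    exact le_iSup₂_of_le x (T.parent x) le_rfl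

theorem measurable_increments : Measurable[gradSigma V] T.increments := by
  rw [T.gradSigma_eq_comap]
  exact comap_measurable _

theorem measurable_height : @Measurable _ _ _ (gradSigma V) T.height := by
  rw [T.gradSigma_eq_comap, measurable_comap_iff]
  convert measurable_id using 1
  exact funext T.increments_height

theorem exists_preimage_increments {A : Set (V → ℤ)} (hA : MeasurableSet[gradSigma V] A) :
    ∃ C, MeasurableSet C ∧ T.increments ⁻¹' C = A := by
  rw [T.gradSigma_eq_comap] at hA
  exact hA

/-! ### Finite sets of descendants. -/

/-- `x` and all its descendants. -/
def descendants (x : V) : Set V := {y | ∃ k, T.parent^[k] y = x}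

theorem self_mem_descendants (x : V) : x ∈ T.descendants x := ⟨0, rfl⟩

theorem parent_notMem_descendants (x : V) : T.parent x ∉ T.descendants x := fun ⟨k, hk⟩ =>
  T.iterate_parent_ne k.succ_pos x hk

theorem mem_descendants_of_parent_mem {x y : V} (h : T.parent y ∈ T.descendants x) :
    y ∈ T.descendants x := by
  obtain ⟨k, hk⟩ := h
  exact ⟨k + 1, hk⟩

/-- Adding the paths from the points of `W` up to `x` suffices. The indicator of such a `Λ` has
increment `-1` at `x`, `0` on the rest of `Λ`, and `1` just below `Λ`, hence away from `W`. -/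
theorem exists_finset_descendants (x : V) (W : Finset V) : ∃ Λ : Finset V,
    (∀ y ∈ Λ, y ∈ T.descendants x) ∧ x ∈ Λ ∧ (∀ y ∈ W, y ∈ T.descendants x → y ∈ Λ) ∧
      ∀ y ∈ Λ, y ≠ x → T.parent y ∈ Λ := by
  classical
  induction W using Finset.induction_on with
  | empty => exact ⟨{x}, by simp [T.self_mem_descendants], by simp, by simp, by simp +contextual⟩
  | insert w W _ ih =>
    obtain ⟨Λ, h1, h2, h3, h4⟩ := ih
    by_cases hw : w ∈ T.descendants x
    · obtain ⟨k, hk⟩ := hw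
      refine ⟨Λ ∪ (Finset.range (k + 1)).image fun i => T.parent^[i] w, ?_, ?_, ?_, ?_⟩
      · intro y hy
        rw [Finset.mem_union, Finset.mem_image] at hy
        rcases hy with hy | ⟨i, hi, rfl⟩
        · exact h1 y hy
        · rw [Finset.mem_range] at hi
          exact ⟨k - i, by rw [← Function.iterate_add_apply, show k - i + i = k by omega, hk]⟩
      · exact Finset.mem_union_left _ h2
      · intro y hy hyd
        rw [Finset.mem_insert] at hy
        rcases hy with rfl | hy
        · exact Finset.mem_union_right _ (Finset.mem_image.2 ⟨0, by simp, rfl⟩)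
        · exact Finset.mem_union_left _ (h3 y hy hyd)
      · intro y hy hne
        rw [Finset.mem_union, Finset.mem_image] at hy
        rcases hy with hy | ⟨i, hi, rfl⟩
        · exact Finset.mem_union_left _ (h4 y hy hne)
        · rw [Finset.mem_range] at hi
          have : i ≠ k := by rintro rfl; exact hne hk
          exact Finset.mem_union_right _ (Finset.mem_image.2
            ⟨i + 1, Finset.mem_range.2 (by omega), Function.iterate_succ_apply' _ _ _⟩)
    · refine ⟨Λ, h1, h2, fun y hy hyd => ?_, h4⟩
      rw [Finset.mem_insert] at hy
      rcases hy with rfl | hy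
      · exact absurd hyd hw
      · exact h3 y hy hyd

end DirectedTree

/-- Cylinders form a ring generating the sigma-algebra, so every measurable set is approximated by
one in symmetric difference for `κ + ν`. -/
theorem MeasureTheory.Measure.le_of_measurableCylinders {ι : Type*} {α : ι → Type*}
    [∀ i, MeasurableSpace (α i)] {κ ν : Measure (∀ i, α i)} [IsFiniteMeasure κ] [IsFiniteMeasure ν]
    (h : ∀ C ∈ measurableCylinders α, κ C ≤ ν C) : κ ≤ ν := by
  refine Measure.le_iff.2 fun s hs => ENNReal.le_of_forall_pos_le_add fun ε hε _ => ?_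
  obtain ⟨t, htC, ht⟩ := exists_measure_symmDiff_lt_of_generateFrom_isSetRing (μ := κ + ν)
    (isSetRing_measurableCylinders (α := α))
    ⟨{Set.univ}, Set.countable_singleton _, by simpa using univ_mem_measurableCylinders α, by simp⟩
    generateFrom_measurableCylinders.symm hs (ε := ε) (by simpa using hε)
  rw [Measure.add_apply] at ht
  calc κ s ≤ κ (t ∪ symmDiff t s) := measure_mono fun x hx => by
        by_cases hxt : x ∈ t
        · exact Or.inl hxt
        · exact Or.inr (Or.inr ⟨hx, hxt⟩)
    _ ≤ κ t + κ (symmDiff t s) := measure_union_le _ _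
    _ ≤ ν t + κ (symmDiff t s) := add_le_add (h t htC) le_rfl
    _ ≤ ν (s ∪ symmDiff t s) + κ (symmDiff t s) := by
        gcongr
        intro x hx
        by_cases hxs : x ∈ s
        · exact Or.inl hxs
        · exact Or.inr (Or.inl ⟨hx, hxs⟩)
    _ ≤ ν s + ν (symmDiff t s) + κ (symmDiff t s) := by gcongr; exact measure_union_le _ _
    _ = ν s + (κ (symmDiff t s) + ν (symmDiff t s)) := by ring
    _ ≤ ν s + ε := by gcongr

/-! ### Partial translations and raising of coordinates. -/

/-- `P` is invariant under the translation by `d`, as a partial map of the set of nonnegative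
functions. -/
def PreservesShift {V : Type*} (P : Measure (V → ℤ)) (d : V → ℤ) : Prop :=
  ∀ E, MeasurableSet E →
    P {ω | 0 ≤ ω ∧ 0 ≤ ω + d ∧ ω + d ∈ E} = P {ω | 0 ≤ ω ∧ 0 ≤ ω - d ∧ ω ∈ E}

/-- Add one on the set `K`. -/
noncomputable def raise {V : Type*} (K : Set V) (ω : V → ℤ) : V → ℤ := ω + K.indicator 1

section raise

variable {V : Type*}

theorem raise_of_mem {K : Set V} {v : V} (h : v ∈ K) (ω : V → ℤ) : raise K ω v = ω v + 1 := by
  simp [raise, h]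

theorem raise_of_notMem {K : Set V} {v : V} (h : v ∉ K) (ω : V → ℤ) : raise K ω v = ω v := by
  simp [raise, h]

@[fun_prop]
theorem measurable_raise (K : Set V) : Measurable (raise K) := by
  unfold raise
  fun_prop

theorem raise_add (K : Set V) (ω d : V → ℤ) : raise K (ω + d) = raise K ω + d := by
  simp only [raise]; abel

theorem measurableSet_one_le (v : V) : MeasurableSet {ω : V → ℤ | 1 ≤ ω v} :=
  measurableSet_le measurable_const (measurable_pi_apply v)

theorem measurableSet_nonneg [Countable V] : MeasurableSet {ω : V → ℤ | 0 ≤ ω} := measurableSet_Ici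

theorem measurableSet_add_mem {E : Set (V → ℤ)} (hE : MeasurableSet E) (d : V → ℤ) :
    MeasurableSet {ω | ω + d ∈ E} := (measurable_add_const d) hE

theorem measurableSet_sub_mem {E : Set (V → ℤ)} (hE : MeasurableSet E) (d : V → ℤ) :
    MeasurableSet {ω | ω - d ∈ E} := (measurable_sub_const d) hE

theorem raise_singleton_self (v : V) (ω : V → ℤ) : raise {v} ω v = ω v + 1 :=
  raise_of_mem (Set.mem_singleton v) ω

theorem raise_singleton_of_ne {v w : V} (h : w ≠ v) (ω : V → ℤ) : raise {v} ω w = ω w :=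
  raise_of_notMem (K := {v}) h ω

theorem le_raise (K : Set V) (ω : V → ℤ) : ω ≤ raise K ω := fun w => by
  by_cases hw : w ∈ K
  · rw [raise_of_mem hw]; exact Int.le_add_one le_rfl
  · rw [raise_of_notMem hw]

theorem raise_nonneg_iff {K : Set V} {ω : V → ℤ} :
    (0 ≤ raise K ω ∧ ∀ v ∈ K, 1 ≤ raise K ω v) ↔ 0 ≤ ω := by
  constructor
  · rintro ⟨h1, h2⟩ w
    by_cases hw : w ∈ K
    · have := h2 w hw
      rw [raise_of_mem hw] at this
      change 0 ≤ ω w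
      omega
    · have := h1 w
      rwa [raise_of_notMem hw] at this
  · intro hω
    refine ⟨hω.trans (le_raise K ω), fun w hw => ?_⟩
    rw [raise_of_mem hw]
    have : 0 ≤ ω w := hω w
    omega

end raise

/-! ### The Gibbs property of increments, and scaling of tail-trivial measures. -/

namespace DirectedTree

variable {V : Type*} (T : DirectedTree V)

/-- The gradient Gibbs property, for the distribution of the increments. -/
structure IsIncrementGibbs (P : Measure (V → ℤ)) : Prop where
  nonneg : ∀ᵐ ω ∂P, 0 ≤ ω
  preservesShift : ∀ g : V →₀ ℤ, PreservesShift P (T.increments g)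

/-- A set of increment functions is local-invariant if it is invariant under finite changes of the
height function. -/
def IsLocalInvariant (A : Set (V → ℤ)) : Prop :=
  ∀ (g : V →₀ ℤ) (ω : V → ℤ), ω + T.increments g ∈ A ↔ ω ∈ A

variable {T}

theorem IsLocalInvariant.compl {A : Set (V → ℤ)} (hA : T.IsLocalInvariant A) :
    T.IsLocalInvariant Aᶜ := fun g ω => not_congr (hA g ω)

theorem IsLocalInvariant.preimage_raise {A : Set (V → ℤ)} (hA : T.IsLocalInvariant A) (K : Set V) :
    T.IsLocalInvariant (raise K ⁻¹' A) := fun g ω => by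
  rw [Set.mem_preimage, Set.mem_preimage, raise_add, hA]

/-- The partial translations do not leave `A`. This lets the domination below be applied to
`P.restrict A`, which is how the zero-one law is obtained. -/
theorem IsIncrementGibbs.restrict {P : Measure (V → ℤ)} (hP : T.IsIncrementGibbs P)
    {A : Set (V → ℤ)} (hAm : MeasurableSet A) (hA : T.IsLocalInvariant A) :
    T.IsIncrementGibbs (P.restrict A) where
  nonneg := ae_restrict_of_ae hP.nonneg
  preservesShift g E hE := by
    rw [Measure.restrict_apply' hAm, Measure.restrict_apply' hAm]
    convert hP.preservesShift g (E ∩ A) (hE.inter hAm) using 2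
    · ext ω
      have := hA g ω
      simp only [Set.mem_inter_iff, Set.mem_ofPred_eq]
      tauto
    · ext ω
      simp only [Set.mem_inter_iff, Set.mem_ofPred_eq]
      tauto

theorem increments_single_nonneg_iff (z : V) {ω : V → ℤ} (hω : 0 ≤ ω) :
    0 ≤ ω + T.increments (Finsupp.single z 1) ↔ 1 ≤ ω z := by
  classical
  simp only [Pi.le_def, Pi.zero_apply, Pi.add_apply, increments_apply, Finsupp.single_apply]
  constructor
  · intro h
    have := h z
    rw [if_neg (T.parent_ne z).symm, if_pos rfl] at this
    omega
  · intro h v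
    have := hω v
    simp only [Pi.zero_apply] at this
    split_ifs with h1 h2 h2 <;> first | omega | (subst h2; omega)

theorem sub_increments_single_nonneg_iff (z : V) {ω : V → ℤ} (hω : 0 ≤ ω) :
    0 ≤ ω - T.increments (Finsupp.single z 1) ↔ ∀ v, T.parent v = z → 1 ≤ ω v := by
  classical
  simp only [Pi.le_def, Pi.zero_apply, Pi.sub_apply, increments_apply, Finsupp.single_apply]
  constructor
  · rintro h v rfl
    have := h v
    rw [if_pos rfl, if_neg (T.parent_ne v)] at this
    omega
  · intro h v
    have := hω v
    have hv := h v
    simp only [Pi.zero_apply] at this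
    split_ifs with h1 h2 h2 <;> first | omega | (have := hv h1.symm; omega)

variable {P : Measure (V → ℤ)}

/-- Raising the height at `z` by one is admissible exactly on the left event, and its inverse
exactly on the right one. This is the source of flow conservation. -/
theorem IsIncrementGibbs.measure_one_le_eq (hP : T.IsIncrementGibbs P) (z : V) :
    P {ω | 1 ≤ ω z} = P {ω | ∀ v, T.parent v = z → 1 ≤ ω v} := by
  have h := hP.preservesShift (Finsupp.single z 1) Set.univ .univ
  convert h using 1 <;> refine measure_congr ?_ <;> filter_upwards [hP.nonneg] with ω hω <;>
    apply propext
  · exact (increments_single_nonneg_iff z hω).symm.trans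
      ⟨fun h => ⟨hω, h, trivial⟩, fun h => h.2.1⟩
  · exact (sub_increments_single_nonneg_iff z hω).symm.trans
      ⟨fun h => ⟨hω, h, trivial⟩, fun h => h.2.1⟩

/-- Raising the heights by one on a finite set `Λ` of descendants is always admissible if `1 ≤ ω v`;
the reverse move also needs room just below `Λ`, so only an inequality results. -/
theorem IsIncrementGibbs.restrict_le_map_raise [IsFiniteMeasure P] (hP : T.IsIncrementGibbs P)
    (v : V) : P.restrict {ω | 1 ≤ ω v} ≤ P.map (raise {v}) := by
  classical
  refine Measure.le_of_measurableCylinders fun C hC => ?_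
  have hCm : MeasurableSet C := MeasurableSet.of_mem_measurableCylinders hC
  obtain ⟨W, S, hS, rfl⟩ := (mem_measurableCylinders C).1 hC
  have hloc : ∀ ω ω' : V → ℤ, (∀ w ∈ W, ω w = ω' w) → ω ∈ cylinder W S → ω' ∈ cylinder W S := by
    intro ω ω' h hω
    rw [mem_cylinder] at hω ⊢
    convert hω using 1
    ext w
    exact (h w w.2).symm
  obtain ⟨Λ, h1, h2, h3, h4⟩ := T.exists_finset_descendants v W
  let g : V →₀ ℤ := Finsupp.indicator Λ fun _ _ => 1
  have hg : ∀ w, g w = if w ∈ Λ then 1 else 0 := fun w => by simp [g, Finsupp.indicator_apply]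
  have hpv : T.parent v ∉ Λ := fun h => T.parent_notMem_descendants v (h1 _ h)
  rw [Measure.restrict_apply hCm, Measure.map_apply (measurable_raise _) hCm]
  have hshift := hP.preservesShift g {ω | ω - T.increments g ∈ cylinder W S}
    (measurableSet_sub_mem hCm _)
  calc P (cylinder W S ∩ {ω | 1 ≤ ω v})
      ≤ P {ω | 0 ≤ ω ∧ 0 ≤ ω + T.increments g ∧
          ω + T.increments g ∈ {ω | ω - T.increments g ∈ cylinder W S}} := by
        refine measure_mono_ae ?_
        filter_upwards [hP.nonneg] with ω hω ⟨hωC, hωv⟩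
        refine ⟨hω, fun w => ?_, ?_⟩
        · have hw := hω w
          simp only [Pi.zero_apply, Pi.add_apply, increments_apply, hg] at hw ⊢
          by_cases hwv : w = v
          · subst hwv
            rw [if_neg hpv, if_pos h2]
            have : 1 ≤ ω w := hωv
            omega
          · by_cases hwΛ : w ∈ Λ
            · rw [if_pos (h4 w hwΛ hwv), if_pos hwΛ]; omega
            · rw [if_neg hwΛ]; split_ifs <;> omega
        · rwa [add_sub_cancel_right]
    _ = _ := hshift
    -- On `W`, undoing the shift is the same as `raise {v}`. The admissibility condition of the
    -- reverse move is dropped.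
    _ ≤ P (raise {v} ⁻¹' cylinder W S) := by
        refine measure_mono ?_
        rintro ω ⟨-, -, hω⟩
        refine hloc _ _ (fun w hw => ?_) hω
        simp only [Pi.sub_apply, increments_apply, hg]
        by_cases hwv : w = v
        · subst hwv
          rw [raise_singleton_self, if_neg hpv, if_pos h2]
          ring
        · rw [raise_singleton_of_ne hwv]
          by_cases hwd : w ∈ T.descendants v
          · have hwΛ := h3 w hw hwd
            rw [if_pos hwΛ, if_pos (h4 w hwΛ hwv)]; ring
          · rw [if_neg fun h => hwd (T.mem_descendants_of_parent_mem (h1 _ h)),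
              if_neg fun h => hwd (h1 _ h)]; ring

/-- Hahn decomposition argument: two measures that are invariant under the same countable family
of partial translations, one dominated by the other, are proportional if the latter is trivial on
the invariant sets. -/
theorem IsIncrementGibbs.restrict_eq_smul_map_raise [Countable V] [IsProbabilityMeasure P]
    (hP : T.IsIncrementGibbs P)
    (htriv : ∀ A, MeasurableSet A → T.IsLocalInvariant A → P A = 0 ∨ P A = 1) (v : V) :
    P.restrict {ω | 1 ≤ ω v} = P {ω | 1 ≤ ω v} • P.map (raise {v}) := by
  have hle := hP.restrict_le_map_raise v
  set κ := P.restrict {ω | 1 ≤ ω v} with hκ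
  set p := P {ω | 1 ≤ ω v} with hp
  set ν := P.map (raise {v}) with hν
  have : IsProbabilityMeasure ν :=
    Measure.isProbabilityMeasure_map (measurable_raise _).aemeasurable
  have : IsFiniteMeasure (p • ν) := Measure.smul_finite _ (measure_ne_top _ _)
  have huniv : κ Set.univ = (p • ν) Set.univ := by simp [hκ, hp]
  let M : Set (V → ℤ) := {ω | 0 ≤ ω ∧ 1 ≤ ω v}
  have hM : MeasurableSet M := measurableSet_nonneg.inter (measurableSet_one_le v)
  have hmem : ∀ ω, raise {v} ω ∈ M ↔ 0 ≤ ω := fun ω => by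
    rw [← raise_nonneg_iff (K := {v})]
    simp [M]
  have hνM : ∀ᵐ ω ∂ν, ω ∈ M := by
    refine (ae_map_iff (measurable_raise _).aemeasurable hM).2 ?_
    filter_upwards [hP.nonneg] with ω hω
    exact (hmem ω).2 hω
  -- both measures are invariant under the partial translations of `M`
  have hκshift : ∀ (g : V →₀ ℤ) (E : Set (V → ℤ)), MeasurableSet E →
      κ {ω | ω ∈ M ∧ ω + T.increments g ∈ M ∧ ω + T.increments g ∈ E} =
      κ {ω | ω ∈ M ∧ ω - T.increments g ∈ M ∧ ω ∈ E} := by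
    intro g E hE
    rw [hκ, Measure.restrict_apply' (measurableSet_one_le v),
      Measure.restrict_apply' (measurableSet_one_le v)]
    convert hP.preservesShift g
      ((E ∩ {ω | 1 ≤ ω v}) ∩ {ω | 1 ≤ (ω - T.increments g) v}) ?_ using 2
    · ext ω
      simp only [M, Set.mem_inter_iff, Set.mem_ofPred_eq, add_sub_cancel_right]
      tauto
    · ext ω
      simp only [M, Set.mem_inter_iff, Set.mem_ofPred_eq]
      tauto
    · exact (hE.inter (measurableSet_one_le v)).inter
        (measurableSet_sub_mem (measurableSet_one_le v) _)
  have hνshift : ∀ (g : V →₀ ℤ) (E : Set (V → ℤ)), MeasurableSet E →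
      ν {ω | ω ∈ M ∧ ω + T.increments g ∈ M ∧ ω + T.increments g ∈ E} =
      ν {ω | ω ∈ M ∧ ω - T.increments g ∈ M ∧ ω ∈ E} := by
    intro g E hE
    rw [hν, Measure.map_apply (measurable_raise _), Measure.map_apply (measurable_raise _)]
    · convert hP.preservesShift g (raise {v} ⁻¹' E) ((measurable_raise _) hE) using 2
      · ext ω
        simp only [Set.mem_preimage, Set.mem_ofPred_eq, ← raise_add, hmem]
      · ext ω
        simp only [Set.mem_preimage, Set.mem_ofPred_eq, sub_eq_add_neg, ← raise_add, hmem]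
    · exact hM.inter ((measurableSet_sub_mem hM _).inter hE)
    · exact hM.inter ((measurableSet_add_mem hM _).inter (measurableSet_add_mem hE _))
  -- `κ` dominates `p • ν` inside `A` and is dominated by it outside. The saturation `⋃ g, E g` of
  -- `A ∩ M` under finite height changes has `ν`-mass zero or one.
  obtain ⟨A, hA, hA1, hA2⟩ := hahn_decomposition κ (p • ν)
  let E : (V →₀ ℤ) → Set (V → ℤ) := fun g => {ω | ω + T.increments g ∈ A ∩ M}
  have hE : ∀ g, MeasurableSet (E g) := fun g => measurableSet_add_mem (hA.inter hM) _
  have hinv : T.IsLocalInvariant (⋃ g, E g) := by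
    intro g ω
    simp only [Set.mem_iUnion, E, Set.mem_ofPred_eq]
    constructor
    · rintro ⟨g', h⟩
      exact ⟨g + g', by simpa [add_assoc] using h⟩
    · rintro ⟨g', h⟩
      exact ⟨g' - g, by simpa [add_assoc] using h⟩
  have hνE : ν (⋃ g, E g) = 0 ∨ ν (⋃ g, E g) = 1 := by
    rw [hν, Measure.map_apply (measurable_raise _) (.iUnion hE)]
    exact htriv _ (measurable_raise _ (.iUnion hE)) (hinv.preimage_raise _)
  rcases hνE with h0 | h1
  · refine Measure.eq_of_le_of_measure_univ_eq ?_ huniv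
    -- Here both measures vanish on `A`, so `κ ≤ p • ν` everywhere, and equal total masses give
    -- equality.
    have hνA : ν A = 0 := by
      refine le_antisymm ((measure_mono_ae ?_).trans h0.le) zero_le
      filter_upwards [hνM] with ω hω hωA
      exact Set.mem_iUnion.2 ⟨0, by simpa [E] using ⟨hωA, hω⟩⟩
    have hκA : κ A = 0 := le_antisymm ((hle A).trans hνA.le) zero_le
    refine Measure.le_iff.2 fun C hC => ?_
    calc κ C ≤ κ (C \ A) + κ A := by
          rw [← measure_sdiff_add_inter C hA]; gcongr; exact Set.inter_subset_right
      _ = κ (C \ A) := by rw [hκA, add_zero]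
      _ ≤ (p • ν) (C \ A) := hA2 _ (hC.diff hA) fun x hx => hx.2
      _ ≤ _ := measure_mono Set.sdiff_subset
  · refine (Measure.eq_of_le_of_measure_univ_eq ?_ huniv.symm).symm
    -- A subset of `E g` is translated by `T.increments g` into `A ∩ M`, where the comparison is
    -- known; both measures are preserved.
    have hpiece : ∀ g C, MeasurableSet C → C ⊆ E g → (p • ν) C ≤ κ C := by
      intro g C hC hCE
      have key : ∀ ρ : Measure (V → ℤ), (∀ᵐ ω ∂ρ, ω ∈ M) →
          ρ {ω | ω ∈ M ∧ ω + T.increments g ∈ M ∧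
            ω + T.increments g ∈ {ω | ω - T.increments g ∈ C}} = ρ C := by
        intro ρ hρ
        refine measure_congr ?_
        filter_upwards [hρ] with ω hω
        apply propext
        simp only [add_sub_cancel_right]
        exact ⟨fun h => h.2.2, fun h => ⟨hω, (hCE h).2, h⟩⟩
      have hC' : MeasurableSet {ω | ω - T.increments g ∈ C} :=
        measurableSet_sub_mem hC _
      rw [Measure.smul_apply, ← key ν hνM, hνshift g _ hC',
        ← key κ (hle.absolutelyContinuous.ae_le hνM), hκshift g _ hC']
      refine hA1 _ ?_ ?_
      · exact hM.inter ((measurableSet_sub_mem hM _).inter hC')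
      · rintro ω ⟨-, -, hω⟩
        have := (hCE hω).1
        rwa [sub_add_cancel] at this
    obtain ⟨f, hf⟩ := exists_surjective_nat (V →₀ ℤ)
    let F : ℕ → Set (V → ℤ) := disjointed fun n => E (f n)
    have hF : ∀ n, MeasurableSet (F n) := MeasurableSet.disjointed fun n => hE _
    have hFU : ⋃ n, F n = ⋃ g, E g := by
      rw [iUnion_disjointed]
      exact hf.iUnion_comp E
    have hsum : ∀ C, MeasurableSet C → ν C = ∑' n, ν (C ∩ F n) := by
      intro C hC
      rw [← measure_iUnion _ fun n => hC.inter (hF n), ← Set.inter_iUnion, hFU]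
      · exact (measure_inter_conull ((prob_compl_eq_zero_iff (.iUnion hE)).2 h1)).symm
      · intro i j hij
        exact (disjoint_disjointed _ hij).mono Set.inter_subset_right Set.inter_subset_right
    refine Measure.le_iff.2 fun C hC => ?_
    calc (p • ν) C = ∑' n, (p • ν) (C ∩ F n) := by
          simp only [Measure.smul_apply, smul_eq_mul, ENNReal.tsum_mul_left, ← hsum C hC]
      _ ≤ ∑' n, κ (C ∩ F n) := ENNReal.tsum_le_tsum fun n =>
          hpiece (f n) _ (hC.inter (hF n)) (Set.inter_subset_right.trans (disjointed_subset _ n))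
      _ = κ (⋃ n, C ∩ F n) := by
          rw [measure_iUnion _ fun n => hC.inter (hF n)]
          intro i j hij
          exact (disjoint_disjointed _ hij).mono Set.inter_subset_right Set.inter_subset_right
      _ ≤ κ C := measure_mono (Set.iUnion_subset fun n => Set.inter_subset_left)

end DirectedTree

/-! ### Geometric weights and distributions. -/

section geometric

theorem geomWeight_zero (α : ℝ≥0∞) : geomWeight α 0 = 1 := by simp [geomWeight]

theorem geomWeight_succ (α : ℝ≥0∞) (k : ℕ) :
    geomWeight α (k + 1) = geomWeight α k * geomWeight α 1 := by
  simp only [geomWeight, EReal.exp_neg, Nat.cast_add, Nat.cast_one, one_mul, add_mul,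
    EReal.coe_ennreal_add, EReal.exp_add]
  refine ENNReal.mul_inv (Or.inl ?_) (Or.inr ?_)
  · rw [ne_eq, EReal.exp_eq_zero_iff]; exact EReal.coe_ennreal_ne_bot _
  · rw [ne_eq, EReal.exp_eq_zero_iff]; exact EReal.coe_ennreal_ne_bot _

theorem geomWeight_eq_pow (α : ℝ≥0∞) (k : ℕ) : geomWeight α k = geomWeight α 1 ^ k := by
  induction k with
  | zero => rw [geomWeight_zero, pow_zero]
  | succ k ih => rw [geomWeight_succ, ih, pow_succ]

theorem geomWeight_one_le_one (α : ℝ≥0∞) : geomWeight α 1 ≤ 1 := by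
  rw [geomWeight, Nat.cast_one, one_mul, EReal.exp_le_one_iff, EReal.neg_le, neg_zero]
  exact EReal.coe_ennreal_nonneg α

theorem geomWeight_one_lt_one {α : ℝ≥0∞} (h : 0 < α) : geomWeight α 1 < 1 := by
  rw [geomWeight, Nat.cast_one, one_mul, EReal.exp_lt_one_iff, EReal.neg_lt_zero]
  exact_mod_cast h

theorem geomWeight_one_strictAnti : StrictAnti fun α => geomWeight α 1 := fun α β h => by
  simp only [geomWeight, Nat.cast_one, one_mul, EReal.exp_lt_exp_iff, EReal.neg_lt_neg_iff]
  exact_mod_cast h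

theorem geomWeight_one_sum {ι : Type*} (s : Finset ι) (f : ι → ℝ≥0∞) :
    geomWeight (∑ i ∈ s, f i) 1 = ∏ i ∈ s, geomWeight (f i) 1 := by
  classical
  induction s using Finset.induction_on with
  | empty => simp [geomWeight]
  | insert i s hi ih =>
    rw [Finset.sum_insert hi, Finset.prod_insert hi, ← ih]
    simp only [geomWeight, EReal.exp_neg, Nat.cast_one, one_mul, EReal.coe_ennreal_add,
      EReal.exp_add]
    refine ENNReal.mul_inv (Or.inl ?_) (Or.inr ?_)
    · rw [ne_eq, EReal.exp_eq_zero_iff]; exact EReal.coe_ennreal_ne_bot _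
    · rw [ne_eq, EReal.exp_eq_zero_iff]; exact EReal.coe_ennreal_ne_bot _

/-- The values of `geomWeight α 1` are all the numbers up to one. -/
theorem exists_geomWeight_one_eq {r : ℝ≥0∞} (hr : r ≤ 1) : ∃ α, geomWeight α 1 = r := by
  refine ⟨(-ENNReal.log r).toENNReal, ?_⟩
  have h : 0 ≤ -ENNReal.log r := by
    rw [EReal.neg_nonneg, ← ENNReal.log_one]
    exact ENNReal.log_monotone hr
  rw [geomWeight, Nat.cast_one, one_mul, EReal.coe_toENNReal h, neg_neg, ENNReal.exp_log]

/-- `α ↦ geomWeight α 1` is an order-reversing bijection onto the numbers up to one, so it exchanges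
suprema and infima. Sums over infinitely many children are handled this way. -/
theorem geomWeight_one_iSup {ι : Type*} (f : ι → ℝ≥0∞) [Nonempty ι] :
    geomWeight (⨆ i, f i) 1 = ⨅ i, geomWeight (f i) 1 := by
  have hanti := geomWeight_one_strictAnti.antitone
  refine le_antisymm (le_iInf fun i => hanti (le_iSup f i)) ?_
  have hle : ⨅ i, geomWeight (f i) 1 ≤ 1 :=
    (iInf_le _ (Classical.arbitrary ι)).trans (geomWeight_one_le_one _)
  obtain ⟨α, hα⟩ := exists_geomWeight_one_eq hle
  rw [← hα]
  refine hanti (iSup_le fun i => ?_)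
  have : geomWeight α 1 ≤ geomWeight (f i) 1 := hα.le.trans (iInf_le _ i)
  exact geomWeight_one_strictAnti.le_iff_ge.1 this

theorem tsum_geomWeight_ne_zero (α : ℝ≥0∞) : ∑' k, geomWeight α k ≠ 0 := by
  intro h
  have := ENNReal.tsum_eq_zero.1 h 0
  rw [geomWeight_zero] at this
  exact one_ne_zero this

theorem tsum_geomWeight_ne_top {α : ℝ≥0∞} (h : 0 < α) : ∑' k, geomWeight α k ≠ ∞ := by
  rw [tsum_congr (geomWeight_eq_pow α), ENNReal.tsum_geometric, ne_eq, ENNReal.inv_eq_top,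
    tsub_eq_zero_iff_le, not_le]
  exact geomWeight_one_lt_one h

theorem geomDist_apply (α : ℝ≥0∞) (t : Set ℤ) :
    geomDist α t =
      (∑' k, geomWeight α k)⁻¹ * ∑' k : ℕ, geomWeight α k * t.indicator 1 (k : ℤ) := by
  have ht : MeasurableSet t := .of_discrete
  rw [geomDist, Measure.smul_apply, Measure.sum_apply _ ht, smul_eq_mul]
  congr 1
  refine tsum_congr fun k => ?_
  rw [Measure.smul_apply, Measure.dirac_apply' _ ht, smul_eq_mul]

theorem isProbabilityMeasure_geomDist {α : ℝ≥0∞} (h : 0 < α) :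
    IsProbabilityMeasure (geomDist α) := by
  refine ⟨?_⟩
  rw [geomDist_apply]
  simp only [Set.indicator_univ, Pi.one_apply, mul_one]
  exact ENNReal.inv_mul_cancel (tsum_geomWeight_ne_zero α) (tsum_geomWeight_ne_top h)

/-- Lack of memory: the point `0` drops out, and each further weight is `geomWeight α 1` times the
preceding one. -/
theorem geomDist_inter_Ici (α : ℝ≥0∞) (t : Set ℤ) :
    geomDist α (t ∩ {k | 1 ≤ k}) = geomWeight α 1 * geomDist α {k | k + 1 ∈ t} := by
  rw [geomDist_apply, geomDist_apply, mul_left_comm]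
  congr 1
  rw [← ENNReal.tsum_mul_left, tsum_eq_zero_add' ENNReal.summable]
  simp only [Nat.cast_zero]
  rw [Set.indicator_of_notMem (by simp), mul_zero, zero_add]
  refine tsum_congr fun k => ?_
  rw [geomWeight_succ, mul_comm (geomWeight α k), mul_assoc]
  congr 2
  by_cases h : (k : ℤ) + 1 ∈ t
  · rw [Set.indicator_of_mem, Set.indicator_of_mem]
    · rfl
    · exact h
    · exact ⟨by exact_mod_cast h, by simp⟩
  · rw [Set.indicator_of_notMem, Set.indicator_of_notMem]
    · exact h
    · exact fun h' => h (by exact_mod_cast h'.1)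

theorem geomDist_neg (α : ℝ≥0∞) : geomDist α {k | ¬ 0 ≤ k} = 0 := by
  rw [geomDist_apply]
  simp

end geometric

/-! ### Scaling at single coordinates characterizes geometric products. -/

section scaling

variable {V : Type*}

/-- The restriction of `P` to `1 ≤ ω v` is `r` times the image of `P` under the map that adds one
at `v`. -/
def ScalesAt (P : Measure (V → ℤ)) (v : V) (r : ℝ≥0∞) : Prop :=
  P.restrict {ω | 1 ≤ ω v} = r • P.map (raise {v})

theorem ScalesAt.measure_inter {P : Measure (V → ℤ)} {v : V} {r : ℝ≥0∞} (h : ScalesAt P v r)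
    {B : Set (V → ℤ)} (hB : MeasurableSet B) :
    P (B ∩ {ω | 1 ≤ ω v}) = r * P (raise {v} ⁻¹' B) := by
  rw [← Measure.restrict_apply hB, h, Measure.smul_apply, Measure.map_apply (measurable_raise _) hB,
    smul_eq_mul]

/-- Iterating the scaling shows that the mass of `ω v = k` within `F` is proportional to `geomWeight
α k`. Summing over `k` gives both the geometric law of `ω v` and its independence of `F`. -/
theorem ScalesAt.measure_eval_inter {P : Measure (V → ℤ)} (hP : ∀ᵐ ω ∂P, 0 ≤ ω) {v : V}
    {α : ℝ≥0∞} (hα : 0 < α) (h : ScalesAt P v (geomWeight α 1)) (t : Set ℤ) {F : Set (V → ℤ)}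
    (hF : MeasurableSet F) (hFv : raise {v} ⁻¹' F = F) :
    P ({ω | ω v ∈ t} ∩ F) = geomDist α t * P F := by
  have hev : ∀ s : Set ℤ, MeasurableSet {ω : V → ℤ | ω v ∈ s} := fun s =>
    measurable_pi_apply v .of_discrete
  have hpow : ∀ k : ℕ, P ({ω | ω v ∈ ({(k : ℤ)} : Set ℤ)} ∩ F) =
      geomWeight α k * P ({ω | ω v ∈ ({0} : Set ℤ)} ∩ F) := by
    intro k
    induction k with
    | zero => simp [geomWeight_zero]
    | succ k ih =>
      have := h.measure_inter ((hev {((k + 1 : ℕ) : ℤ)}).inter hF)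
      rw [Set.preimage_inter, hFv] at this
      rw [geomWeight_succ, mul_comm (geomWeight α k), mul_assoc, ← ih]
      convert this using 2
      · ext ω
        simp only [Set.mem_inter_iff, Set.mem_ofPred_eq, Set.mem_singleton_iff]
        constructor
        · rintro ⟨h1, h2⟩
          exact ⟨⟨h1, h2⟩, by rw [h1]; push_cast; omega⟩
        · exact fun h => h.1
      · congr 2
        ext ω
        simp only [Set.mem_preimage, Set.mem_ofPred_eq, Set.mem_singleton_iff,
          raise_singleton_self]
        push_cast
        omega
  set c := P ({ω | ω v ∈ ({0} : Set ℤ)} ∩ F)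
  have hsum : ∀ t : Set ℤ, P ({ω | ω v ∈ t} ∩ F) =
      (∑' k : ℕ, geomWeight α k * t.indicator 1 (k : ℤ)) * c := by
    intro t
    have hae : P ({ω | ω v ∈ t} ∩ F) =
        P (⋃ k : ℕ, {ω | ω v ∈ ({(k : ℤ)} : Set ℤ) ∩ t} ∩ F) := by
      refine measure_congr ?_
      filter_upwards [hP] with ω hω
      apply propext
      change (ω v ∈ t ∧ ω ∈ F) ↔ ω ∈ ⋃ k : ℕ, _
      simp only [Set.mem_iUnion, Set.mem_inter_iff, Set.mem_ofPred_eq, Set.mem_singleton_iff]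
      obtain ⟨n, hn⟩ := Int.eq_ofNat_of_zero_le (hω v)
      exact ⟨fun h => ⟨n, ⟨hn, h.1⟩, h.2⟩, fun ⟨_, h⟩ => ⟨h.1.2, h.2⟩⟩
    rw [hae, measure_iUnion, ← ENNReal.tsum_mul_right]
    · refine tsum_congr fun k => ?_
      by_cases hk : (k : ℤ) ∈ t
      · rw [Set.indicator_of_mem hk, Pi.one_apply, mul_one, ← hpow,
          Set.inter_eq_left.2 (Set.singleton_subset_iff.2 hk)]
      · rw [Set.indicator_of_notMem hk, mul_zero, zero_mul,
          (Set.disjoint_singleton_left.2 hk).inter_eq]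
        simp
    · intro i j hij
      refine Set.disjoint_left.2 ?_
      rintro ω ⟨⟨h1, -⟩, -⟩ ⟨⟨h2, -⟩, -⟩
      exact hij (by exact_mod_cast (show ((i : ℕ) : ℤ) = j from h1.symm.trans h2))
    · exact fun k => (hev _).inter hF
  have huniv := hsum Set.univ
  simp only [Set.mem_univ, Set.ofPred_true, Set.univ_inter, Set.indicator_univ, Pi.one_apply,
    mul_one] at huniv
  rw [hsum, geomDist_apply, huniv, mul_comm _⁻¹, mul_assoc, ← mul_assoc _⁻¹,
    ENNReal.inv_mul_cancel (tsum_geomWeight_ne_zero α) (tsum_geomWeight_ne_top hα), one_mul]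

/-- The distribution of independent geometric variables. -/
noncomputable def geomProduct (φ : V → ℝ≥0∞) : Measure (V → ℤ) :=
  Measure.infinitePi fun v => geomDist (φ v)

variable {φ : V → ℝ≥0∞}

/-- Peeling off one coordinate at a time evaluates every finite box. The total mass is left free
because restrictions to events are also treated. -/
theorem eq_smul_geomProduct {P : Measure (V → ℤ)} [IsFiniteMeasure P] (hφ : ∀ v, 0 < φ v)
    (hP : ∀ᵐ ω ∂P, 0 ≤ ω) (h : ∀ v, ScalesAt P v (geomWeight (φ v) 1)) :
    P = P Set.univ • geomProduct φ := by
  classical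
  have := fun v => isProbabilityMeasure_geomDist (hφ v)
  by_cases h0 : P Set.univ = 0
  · rw [h0, zero_smul]
    exact Measure.measure_univ_eq_zero.1 h0
  have hfin : P Set.univ ≠ ∞ := measure_ne_top _ _
  have hbox : ∀ (s : Finset V) (t : V → Set ℤ),
      P ((s : Set V).pi t) = (∏ v ∈ s, geomDist (φ v) (t v)) * P Set.univ := by
    intro s t
    induction s using Finset.induction_on with
    | empty => simp
    | insert v s hv ih =>
      have hm : MeasurableSet ((s : Set V).pi t) :=
        MeasurableSet.pi s.countable_toSet fun _ _ => .of_discrete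
      rw [Finset.prod_insert hv, mul_assoc, ← ih, Finset.coe_insert, Set.insert_pi]
      refine (h v).measure_eval_inter hP (hφ v) (t v) hm ?_
      ext ω
      simp only [Set.mem_preimage, Set.mem_pi]
      refine forall₂_congr fun w hw => ?_
      rw [raise_singleton_of_ne]
      rintro rfl
      exact hv hw
  have key : (P Set.univ)⁻¹ • P = geomProduct φ := by
    refine Measure.eq_infinitePi _ fun s t _ => ?_
    rw [Measure.smul_apply, hbox, smul_eq_mul, mul_comm, mul_assoc, ENNReal.mul_inv_cancel h0 hfin,
      mul_one]
  rw [← key, smul_smul, ENNReal.mul_inv_cancel h0 hfin, one_smul]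

theorem isProbabilityMeasure_geomProduct (hφ : ∀ v, 0 < φ v) :
    IsProbabilityMeasure (geomProduct φ) := by
  have := fun v => isProbabilityMeasure_geomDist (hφ v)
  unfold geomProduct
  infer_instance

theorem map_eval_geomProduct (hφ : ∀ v, 0 < φ v) (v : V) :
    (geomProduct φ).map (fun ω => ω v) = geomDist (φ v) := by
  have := fun v => isProbabilityMeasure_geomDist (hφ v)
  exact Measure.infinitePi_map_eval _ v

theorem geomProduct_nonneg [Countable V] (hφ : ∀ v, 0 < φ v) : ∀ᵐ ω ∂geomProduct φ, 0 ≤ ω := by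
  simp only [Pi.le_def, ae_all_iff]
  intro v
  refine ae_of_ae_map (μ := geomProduct φ) (f := fun ω => ω v) (p := fun k => (0 : ℤ) ≤ k)
    (measurable_pi_apply v).aemeasurable ?_
  rw [map_eval_geomProduct hφ]
  exact geomDist_neg _

theorem scalesAt_geomProduct (hφ : ∀ v, 0 < φ v) (v : V) :
    ScalesAt (geomProduct φ) v (geomWeight (φ v) 1) := by
  classical
  have := fun v => isProbabilityMeasure_geomDist (hφ v)
  have hprob := isProbabilityMeasure_geomProduct hφ
  have hbox : ∀ (s : Finset V) (t : V → Set ℤ), geomProduct φ ((s : Set V).pi t) =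
      ∏ w ∈ s, geomDist (φ w) (t w) := fun s t =>
    Measure.infinitePi_pi _ fun _ _ => .of_discrete
  refine ext_of_generate_finite _ generateFrom_squareCylinders.symm
    (isPiSystem_squareCylinders (fun _ => MeasurableSpace.isPiSystem_measurableSet) (by simp)) ?_ ?_
  · intro B hB
    obtain ⟨s, t, -, rfl⟩ := hB
    have hm : MeasurableSet ((s : Set V).pi t) :=
      MeasurableSet.pi s.countable_toSet fun _ _ => .of_discrete
    -- Every box is rewritten with the factor at `v` separated, whether or not `v ∈ s`; both sides
    -- then differ only in that factor.
    let u : Set ℤ → V → Set ℤ := fun a =>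
      Function.update (fun w => if w ∈ s then t w else Set.univ) v a
    have hu : ∀ a, geomProduct φ (((insert v (s.erase v) : Finset V) : Set V).pi (u a)) =
        geomDist (φ v) a * ∏ w ∈ s.erase v, geomDist (φ w) (t w) := by
      intro a
      rw [hbox, Finset.prod_insert (Finset.notMem_erase v s)]
      congr 1
      · simp [u]
      · refine Finset.prod_congr rfl fun w hw => ?_
        rw [Finset.mem_erase] at hw
        simp [u, hw.1, hw.2]
    let a : Set ℤ := if v ∈ s then t v else Set.univ
    have hmem : ∀ (b : Set ℤ) (ω : V → ℤ),
        ω ∈ ((insert v (s.erase v) : Finset V) : Set V).pi (u b) ↔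
          ω v ∈ b ∧ ∀ w, w ≠ v → w ∈ s → ω w ∈ t w := by
      intro b ω
      simp only [Set.mem_pi, Finset.mem_coe, Finset.mem_insert, Finset.mem_erase, forall_eq_or_imp,
        u, Function.update_self, and_imp]
      refine and_congr Iff.rfl (forall₃_congr fun w hw hws => ?_)
      rw [Function.update_of_ne hw, if_pos hws]
    have hmem' : ∀ ω : V → ℤ, ω ∈ (s : Set V).pi t ↔
        ω v ∈ a ∧ ∀ w, w ≠ v → w ∈ s → ω w ∈ t w := by
      intro ω
      simp only [Set.mem_pi, Finset.mem_coe, a]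
      constructor
      · intro h
        refine ⟨?_, fun w _ hws => h w hws⟩
        split_ifs with hv
        · exact h v hv
        · trivial
      · rintro ⟨h1, h2⟩ w hw
        by_cases hwv : w = v
        · subst hwv
          rwa [if_pos hw] at h1
        · exact h2 w hwv hw
    have h1 : (s : Set V).pi t ∩ {ω | 1 ≤ ω v} =
        ((insert v (s.erase v) : Finset V) : Set V).pi (u (a ∩ {k | 1 ≤ k})) := by
      ext ω
      rw [hmem, Set.mem_inter_iff, hmem']
      exact and_right_comm
    have h2 : raise {v} ⁻¹' ((s : Set V).pi t) =
        ((insert v (s.erase v) : Finset V) : Set V).pi (u {k | k + 1 ∈ a}) := by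
      ext ω
      rw [hmem, Set.mem_preimage, hmem', raise_singleton_self]
      refine and_congr Iff.rfl (forall₂_congr fun w hw => ?_)
      rw [raise_singleton_of_ne hw]
    rw [Measure.restrict_apply hm, Measure.smul_apply, Measure.map_apply (measurable_raise _) hm,
      h1, h2, hu, hu, geomDist_inter_Ici, smul_eq_mul, mul_assoc]
  · have := hbox {v} fun _ => {k | 1 ≤ k}
    have h2 := geomDist_inter_Ici (φ v) Set.univ
    simp only [Set.univ_inter, Set.mem_univ, Set.ofPred_true, measure_univ, mul_one] at h2
    rw [Finset.prod_singleton, h2] at this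
    rw [Measure.restrict_apply_univ, Measure.smul_apply, Measure.map_apply (measurable_raise _) .univ]
    simp only [Set.preimage_univ, measure_univ, smul_eq_mul, mul_one]
    rw [← this]
    congr 1
    ext ω
    simp

end scaling

/-! ### Raising infinitely many coordinates at once. -/

section scaling

variable {V : Type*}

theorem raise_union_of_disjoint {K L : Set V} (h : Disjoint K L) (ω : V → ℤ) :
    raise (K ∪ L) ω = raise K (raise L ω) := by
  simp only [raise, Set.indicator_union_of_disjoint h, add_assoc]
  congr 1
  exact add_comm _ _

theorem measurableSet_forall_one_le [Countable V] (K : Set V) :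
    MeasurableSet {ω : V → ℤ | ∀ v ∈ K, 1 ≤ ω v} := by
  have : {ω : V → ℤ | ∀ v ∈ K, 1 ≤ ω v} = ⋂ v ∈ K, {ω | 1 ≤ ω v} := by ext; simp
  rw [this]
  exact .biInter K.to_countable fun v _ => measurableSet_one_le v

theorem measure_inter_forall_one_le_finset [Countable V] {P : Measure (V → ℤ)} {r : V → ℝ≥0∞}
    (h : ∀ v, ScalesAt P v (r v)) (S : Finset V) {B : Set (V → ℤ)} (hB : MeasurableSet B) :
    P (B ∩ {ω | ∀ v ∈ (S : Set V), 1 ≤ ω v}) = (∏ v ∈ S, r v) * P (raise (S : Set V) ⁻¹' B) := by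
  classical
  induction S using Finset.induction_on generalizing B with
  | empty =>
    have : raise (∅ : Set V) ⁻¹' B = B := by
      ext ω
      rw [Set.mem_preimage, raise, Set.indicator_empty, ← Pi.zero_def, add_zero]
    simp [this]
  | insert v S hv ih =>
    have hset : B ∩ {ω | ∀ w ∈ ((insert v S : Finset V) : Set V), 1 ≤ ω w} =
        (B ∩ {ω | 1 ≤ ω v}) ∩ {ω | ∀ w ∈ (S : Set V), 1 ≤ ω w} := by
      ext ω
      simp [and_assoc]
    have hpre : raise (S : Set V) ⁻¹' (B ∩ {ω | 1 ≤ ω v}) =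
        (raise (S : Set V) ⁻¹' B) ∩ {ω | 1 ≤ ω v} := by
      ext ω
      simp only [Set.mem_preimage, Set.mem_inter_iff, Set.mem_ofPred_eq]
      rw [raise_of_notMem (K := (S : Set V)) hv]
    rw [hset, ih (hB.inter (measurableSet_one_le v)), hpre,
      (h v).measure_inter (measurable_raise _ hB), Finset.prod_insert hv, ← mul_assoc,
      mul_comm (r v)]
    congr 2
    ext ω
    simp only [Set.mem_preimage]
    rw [Finset.coe_insert, Set.insert_eq, Set.union_comm, raise_union_of_disjoint]
    exact Set.disjoint_singleton_right.2 hv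

/-- A vertex may have infinitely many children, so `K` may be infinite: continuity from above along
finite subsets of `K` replaces the finite product by its infimum. -/
theorem restrict_forall_one_le [Countable V] {P : Measure (V → ℤ)} [IsFiniteMeasure P]
    {r : V → ℝ≥0∞} (hr : ∀ v, r v ≤ 1) (h : ∀ v, ScalesAt P v (r v)) (K : Set V) :
    P.restrict {ω | ∀ v ∈ K, 1 ≤ ω v} =
      (⨅ S : Finset K, ∏ v ∈ S, r v) • P.map (raise K) := by
  classical
  have hinf : ∀ {B : Set (V → ℤ)}, MeasurableSet B → P (B ∩ {ω | ∀ v ∈ K, 1 ≤ ω v}) =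
      ⨅ S : Finset K, (∏ v ∈ S, r v) *
        P (raise ((S.map (Function.Embedding.subtype _) : Finset V) : Set V) ⁻¹' B) := by
    intro B hB
    have : B ∩ {ω | ∀ v ∈ K, 1 ≤ ω v} = ⋂ S : Finset K, B ∩
        {ω | ∀ v ∈ ((S.map (Function.Embedding.subtype _) : Finset V) : Set V), 1 ≤ ω v} := by
      ext ω
      simp only [Set.mem_inter_iff, Set.mem_iInter, Set.mem_ofPred_eq, Finset.mem_coe,
        Finset.mem_map, Function.Embedding.subtype_apply]
      constructor
      · rintro ⟨h1, h2⟩ S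
        refine ⟨h1, ?_⟩
        rintro v ⟨w, -, rfl⟩
        exact h2 w w.2
      · intro h
        exact ⟨(h ∅).1, fun v hv => (h {⟨v, hv⟩}).2 v ⟨⟨v, hv⟩, by simp, rfl⟩⟩
    rw [this, Directed.measure_iInter]
    · refine iInf_congr fun S => ?_
      rw [measure_inter_forall_one_le_finset h _ hB, Finset.prod_map]
      rfl
    · exact fun S => (hB.inter (measurableSet_forall_one_le _)).nullMeasurableSet
    · refine directed_of_isDirected_le fun S S' hSS' => ?_
      refine Set.inter_subset_inter_right _ fun ω hω v hv => hω v ?_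
      exact Finset.map_subset_map.2 hSS' hv
    · exact ⟨∅, measure_ne_top _ _⟩
  have hanti : Antitone fun S : Finset K => ∏ v ∈ S, r v := fun S S' hSS' =>
    Finset.prod_le_prod_of_subset_of_le_one' hSS' fun v _ _ => hr v
  have hK : Measurable (raise K) := measurable_raise K
  have hcyl : ∀ B ∈ measurableCylinders (fun _ : V => ℤ),
      P.restrict {ω | ∀ v ∈ K, 1 ≤ ω v} B =
        ((⨅ S : Finset K, ∏ v ∈ S, r v) • P.map (raise K)) B := by
    intro B hB
    have hBm : MeasurableSet B := .of_mem_measurableCylinders hB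
    obtain ⟨W, S₀, -, rfl⟩ := (mem_measurableCylinders B).1 hB
    have hmono : Antitone fun S : Finset K => (∏ v ∈ S, r v) *
        P (raise ((S.map (Function.Embedding.subtype _) : Finset V) : Set V) ⁻¹'
          cylinder W S₀) := by
      intro S S' hSS'
      have := fun S : Finset K => measure_inter_forall_one_le_finset h
        (S.map (Function.Embedding.subtype _)) hBm
      simp only [Finset.prod_map, Function.Embedding.subtype_apply] at this
      simp only [← this]
      refine measure_mono (Set.inter_subset_inter_right _ fun ω hω v hv => hω v ?_)
      exact Finset.map_subset_map.2 hSS' hv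
    rw [Measure.restrict_apply hBm, hinf hBm, Measure.smul_apply, Measure.map_apply hK hBm,
      smul_eq_mul, 
      ENNReal.iInf_mul' (fun h => absurd h (measure_ne_top _ _)) fun _ => inferInstance]
    -- A cylinder over `W` cannot tell `raise S` from `raise K` once `S` contains `W ∩ K`. The
    -- infimum over `S` then affects the product alone.
    have hlarge : ∀ S : Finset K, raise (((S ∪ W.subtype (· ∈ K)).map
        (Function.Embedding.subtype _) : Finset V) : Set V) ⁻¹' cylinder W S₀ =
          raise K ⁻¹' cylinder W S₀ := by
      intro S
      ext ω
      simp only [Set.mem_preimage, mem_cylinder]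
      refine iff_of_eq (congrArg (· ∈ S₀) ?_)
      ext ⟨w, hw⟩
      simp only [Finset.restrict]
      by_cases hwK : w ∈ K
      · rw [raise_of_mem hwK, raise_of_mem]
        simp [hw, hwK]
      · rw [raise_of_notMem hwK, raise_of_notMem]
        simp [hwK]
    refine le_antisymm (le_iInf fun S => ?_) (le_iInf fun S => ?_)
    · refine (iInf_le _ (S ∪ W.subtype (· ∈ K))).trans ?_
      rw [hlarge]
      exact mul_le_mul' (hanti Finset.subset_union_left) le_rfl
    · refine (iInf_le _ (S ∪ W.subtype (· ∈ K))).trans ?_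
      rw [← hlarge S]
      exact hmono Finset.subset_union_left
  refine ext_of_generate_finite _ generateFrom_measurableCylinders.symm
    isPiSystem_measurableCylinders hcyl (hcyl _ (univ_mem_measurableCylinders _))

end scaling

/-! ### Generating all finite height changes from single vertices. -/

section shifts

variable {V : Type*} {P : Measure (V → ℤ)}

theorem preservesShift_zero : PreservesShift P 0 := fun E _ => by simp

theorem PreservesShift.neg {d : V → ℤ} (h : PreservesShift P d) : PreservesShift P (-d) := by
  intro E hE
  have := h _ (measurableSet_sub_mem hE d)
  simp only [Set.mem_ofPred_eq, add_sub_cancel_right] at this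
  simp only [← sub_eq_add_neg, sub_neg_eq_add]
  exact this.symm

/-- The condition `h` keeps the intermediate point nonnegative, without which partial translations
do not compose. -/
theorem PreservesShift.add [Countable V] {d e : V → ℤ} (hd : PreservesShift P d)
    (he : PreservesShift P e)
    (h : ∀ ω, 0 ≤ ω → 0 ≤ ω + (d + e) → 0 ≤ ω + d) : PreservesShift P (d + e) := by
  intro E hE
  have h1 := hd {ω | 0 ≤ ω + e ∧ ω + e ∈ E}
    ((measurableSet_add_mem measurableSet_nonneg e).inter (measurableSet_add_mem hE e))
  have h2 := he {ω | 0 ≤ ω - e - d ∧ ω ∈ E} (by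
    have := (measurableSet_sub_mem (measurableSet_nonneg (V := V)) (e + d)).inter hE
    simp only [sub_sub]
    exact this)
  calc P {ω | 0 ≤ ω ∧ 0 ≤ ω + (d + e) ∧ ω + (d + e) ∈ E}
      = P {ω | 0 ≤ ω ∧ 0 ≤ ω + d ∧ ω + d ∈ {ω | 0 ≤ ω + e ∧ ω + e ∈ E}} := by
        congr 1
        ext ω
        simp only [Set.mem_ofPred_eq, add_assoc]
        exact ⟨fun ⟨a, b, c⟩ => ⟨a, h ω a b, b, c⟩, fun ⟨a, _, b, c⟩ => ⟨a, b, c⟩⟩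
    _ = _ := h1
    _ = P {ω | 0 ≤ ω ∧ 0 ≤ ω + e ∧ ω + e ∈ {ω | 0 ≤ ω - e - d ∧ ω ∈ E}} := by
        congr 1
        ext ω
        simp only [Set.mem_ofPred_eq, add_sub_cancel_right]
        tauto
    _ = _ := h2
    _ = _ := by
        congr 1
        ext ω
        simp only [Set.mem_ofPred_eq, sub_sub, add_comm e d]
        refine ⟨fun ⟨a, _, b, c⟩ => ⟨a, b, c⟩, fun ⟨a, b, c⟩ => ⟨a, ?_, b, c⟩⟩
        have := h (ω - (d + e)) b (by rwa [sub_add_cancel])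
        rwa [show ω - (d + e) + d = ω - e by abel] at this

namespace DirectedTree

variable {T : DirectedTree V}

theorem increments_single (z : V) : T.increments (Finsupp.single z 1) =
    {v | T.parent v = z}.indicator 1 - ({z} : Set V).indicator 1 := by
  classical
  ext v
  simp only [increments_apply, Finsupp.single_apply, Pi.sub_apply, Set.indicator_apply,
    Set.mem_ofPred_eq, Set.mem_singleton_iff, Pi.one_apply, eq_comm]

/-- Raising the height at `z` takes one unit from `ω z` and gives one to each child. Scaling at `z`
and along all children evaluates both sides as the same multiple of the mass of `raise {v | T.parent
v = z} ⁻¹' E`. -/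
theorem preservesShift_single [Countable V] [IsFiniteMeasure P] {r : V → ℝ≥0∞}
    (hP : ∀ᵐ ω ∂P, 0 ≤ ω) (hr : ∀ v, r v ≤ 1) (h : ∀ v, ScalesAt P v (r v)) (z : V)
    (hz : r z = ⨅ S : Finset {v | T.parent v = z}, ∏ v ∈ S, r v) :
    PreservesShift P (T.increments (Finsupp.single z 1)) := by
  intro E hE
  set d := T.increments (Finsupp.single z 1) with hd
  have h1 := (h z).measure_inter (measurableSet_add_mem hE d)
  have h2 := congrArg (fun ρ : Measure (V → ℤ) => ρ E)
    (restrict_forall_one_le hr h {v | T.parent v = z})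
  rw [← hz] at h2
  simp only [Measure.restrict_apply hE, Measure.smul_apply,
    Measure.map_apply (measurable_raise _) hE, smul_eq_mul] at h2
  have h3 : raise {z} ⁻¹' {ω | ω + d ∈ E} = raise {v | T.parent v = z} ⁻¹' E := by
    ext ω
    simp only [Set.mem_preimage, Set.mem_ofPred_eq, hd, increments_single, raise]
    rw [show ω + ({z} : Set V).indicator 1 +
      ({v | T.parent v = z}.indicator 1 - ({z} : Set V).indicator 1) =
      ω + {v | T.parent v = z}.indicator 1 by abel]
  rw [h3, ← h2] at h1
  convert h1 using 1 <;> refine measure_congr ?_ <;> filter_upwards [hP] with ω hω <;>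
    apply propext
  · have := increments_single_nonneg_iff (T := T) z hω
    exact ⟨fun ⟨_, b, c⟩ => ⟨c, this.1 b⟩, fun ⟨a, b⟩ => ⟨hω, this.2 b, a⟩⟩
  · have := sub_increments_single_nonneg_iff (T := T) z hω
    exact ⟨fun ⟨_, b, c⟩ => ⟨c, this.1 b⟩, fun ⟨a, b⟩ => ⟨hω, this.2 b, a⟩⟩

/-- Otherwise `g` stays positive along an entire ancestral line, which leaves the finite support. -/
theorem exists_pos_parent_lt {g : V →₀ ℤ} (h : ∃ v, 0 < g v) :
    ∃ v, 0 < g v ∧ g (T.parent v) < g v := by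
  by_contra! hc
  obtain ⟨v, hv⟩ := h
  have key : ∀ k, 0 < g (T.parent^[k] v) := by
    intro k
    induction k with
    | zero => exact hv
    | succ k ih =>
      rw [Function.iterate_succ_apply']
      exact ih.trans_le (hc _ ih)
  obtain ⟨k, hk⟩ := T.exists_iterate_parent_notMem g.support v
  have := key k
  rw [Finsupp.notMem_support_iff.1 hk] at this
  exact lt_irrefl _ this

/-- Induction on the total size of `g`. At a `v` with `0 < g v` and `g (T.parent v) < g v`,
nonnegativity after the full shift forces `1 ≤ ω v` before it, so one unit at `v` can be split off
first. A `g` without positive values is treated through `-g`. -/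
theorem preservesShift_of_single [Countable V]
    (h : ∀ z, PreservesShift P (T.increments (Finsupp.single z 1))) (g : V →₀ ℤ) :
    PreservesShift P (T.increments g) := by
  classical
  suffices H : ∀ (n : ℕ) (g : V →₀ ℤ), g.sum (fun _ k => k.natAbs) = n →
      PreservesShift P (T.increments g) from H _ g rfl
  intro n
  induction n using Nat.strong_induction_on with
  | _ n ih =>
    have key : ∀ g : V →₀ ℤ, g.sum (fun _ k => k.natAbs) = n → (∃ v, 0 < g v) →
        PreservesShift P (T.increments g) := by
      intro g hg hpos
      obtain ⟨v, hv, hpv⟩ := exists_pos_parent_lt (T := T) hpos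
      have hsplit : T.increments g = T.increments (Finsupp.single v 1) +
          T.increments (g - Finsupp.single v 1 : V →₀ ℤ) := by
        rw [← map_add]
        congr 1
        ext w
        simp
      rw [hsplit]
      refine (h v).add (ih _ ?_ _ rfl) ?_
      · have hsub : (g - Finsupp.single v 1).support ⊆ g.support := by
          intro w hw
          rw [Finsupp.mem_support_iff] at hw ⊢
          intro h0
          by_cases hwv : v = w
          · subst hwv; omega
          · rw [Finsupp.sub_apply, Finsupp.single_eq_of_ne' hwv, h0] at hw
            exact hw rfl
        rw [← hg, Finsupp.sum_of_support_subset _ hsub _ (by simp), Finsupp.sum]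
        refine Finset.sum_lt_sum (fun w _ => ?_) ⟨v, Finsupp.mem_support_iff.2 hv.ne', ?_⟩
        · by_cases hwv : v = w
          · subst hwv
            rw [Finsupp.sub_apply, Finsupp.single_eq_same]
            omega
          · rw [Finsupp.sub_apply, Finsupp.single_eq_of_ne' hwv, sub_zero]
        · rw [Finsupp.sub_apply, Finsupp.single_eq_same]
          omega
      · intro ω hω hω'
        rw [← hsplit] at hω'
        rw [increments_single_nonneg_iff v hω]
        have : 0 ≤ ω v + (g (T.parent v) - g v) := hω' v
        omega
    intro g hg
    by_cases hpos : ∃ v, 0 < g v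
    · exact key g hg hpos
    by_cases hneg : ∃ v, g v < 0
    · have := key (-g) (by rw [← hg, Finsupp.sum_neg_index (by simp)]; simp) (by simpa using hneg)
      have := this.neg
      rwa [Finsupp.coe_neg, map_neg, neg_neg] at this
    · have : g = 0 := by
        ext v
        simp only [not_exists, not_lt] at hpos hneg
        exact le_antisymm (hpos v) (hneg v)
      subst this
      rw [Finsupp.coe_zero, map_zero]
      exact preservesShift_zero

end DirectedTree

end shifts

/-! ### Products given by flows, the zero-one law, and the converse. -/

namespace DirectedTree

variable {V : Type*} {T : DirectedTree V} {φ : V → ℝ≥0∞}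

theorem geomWeight_eq_iInf_prod {z : V} (h : φ z = ∑' v : {v | T.parent v = z}, φ v) :
    geomWeight (φ z) 1 =
      ⨅ S : Finset {v | T.parent v = z}, ∏ v ∈ S, geomWeight (φ v) 1 := by
  rw [h, ENNReal.tsum_eq_iSup_sum, geomWeight_one_iSup]
  exact iInf_congr fun S => geomWeight_one_sum S _

theorem isIncrementGibbs_geomProduct [Countable V] (hφ : ∀ v, 0 < φ v)
    (h : ∀ z, φ z = ∑' v : {v | T.parent v = z}, φ v) : T.IsIncrementGibbs (geomProduct φ) := by
  have := isProbabilityMeasure_geomProduct hφ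
  exact ⟨geomProduct_nonneg hφ, preservesShift_of_single fun z =>
    preservesShift_single (geomProduct_nonneg hφ) (fun v => geomWeight_one_le_one (φ v))
      (scalesAt_geomProduct hφ) z (geomWeight_eq_iInf_prod (h z))⟩

/-- Domination for `P.restrict C` is tested on the image of `raise {v} ⁻¹' C \ C` under `raise {v}`:
the upper bound is zero, while scaling evaluates the other side as the stated product. -/
theorem IsIncrementGibbs.measure_preimage_raise_sdiff {P : Measure (V → ℤ)} [IsFiniteMeasure P]
    (hP : T.IsIncrementGibbs P) {v : V} {r : ℝ≥0∞} (h : ScalesAt P v r) {C : Set (V → ℤ)}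
    (hC : MeasurableSet C) (hinv : T.IsLocalInvariant C) :
    r * P (raise {v} ⁻¹' C \ C) = 0 := by
  have hX : MeasurableSet (raise {v} ⁻¹' C \ C) := ((measurable_raise _) hC).diff hC
  have hB := measurableSet_sub_mem hX (({v} : Set V).indicator 1)
  set B := {ω | ω - ({v} : Set V).indicator 1 ∈ raise {v} ⁻¹' C \ C} with hBdef
  have hpre : raise {v} ⁻¹' B = raise {v} ⁻¹' C \ C := by
    ext ω
    simp only [hBdef, raise, Set.mem_preimage, Set.mem_ofPred_eq, add_sub_cancel_right]
  have h1 := (hP.restrict hC hinv).restrict_le_map_raise v B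
  rw [Measure.restrict_apply hB, Measure.restrict_apply' hC,
    Measure.map_apply (measurable_raise _) hB, hpre, Measure.restrict_apply hX,
    Set.sdiff_inter_self, measure_empty] at h1
  have h2 := h.measure_inter (hB.inter hC)
  rw [Set.preimage_inter, hpre, Set.inter_right_comm, le_antisymm h1 zero_le,
    Set.inter_eq_left.2 Set.sdiff_subset] at h2
  exact h2.symm

/-- The zero-one law for independent geometric variables that satisfy the Gibbs property. -/
theorem geomProduct_eq_zero_or_one [Countable V] (hφ : ∀ v, 0 < φ v)
    (h : T.IsIncrementGibbs (geomProduct φ)) {C : Set (V → ℤ)} (hC : MeasurableSet C)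
    (hinv : T.IsLocalInvariant C) : geomProduct φ C = 0 ∨ geomProduct φ C = 1 := by
  have := isProbabilityMeasure_geomProduct hφ
  set P := geomProduct φ with hPdef
  have hscale : ∀ v, ScalesAt (P.restrict C) v (geomWeight (φ v) 1) := by
    intro v
    have hs := scalesAt_geomProduct hφ v
    refine Measure.ext fun B hB => ?_
    rw [Measure.restrict_apply hB, Measure.restrict_apply' hC, Measure.smul_apply,
      Measure.map_apply (measurable_raise _) hB, Measure.restrict_apply' hC, Set.inter_right_comm,
      hs.measure_inter (hB.inter hC), smul_eq_mul, Set.preimage_inter]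
    by_cases hr : geomWeight (φ v) 1 = 0
    · rw [hr, zero_mul, zero_mul]
    congr 1
    have h1 := (mul_eq_zero.1 (h.measure_preimage_raise_sdiff hs hC hinv)).resolve_left hr
    have h2 := (mul_eq_zero.1
      (h.measure_preimage_raise_sdiff hs hC.compl hinv.compl)).resolve_left hr
    refine measure_congr ?_
    filter_upwards [measure_eq_zero_iff_ae_notMem.1 h1, measure_eq_zero_iff_ae_notMem.1 h2]
      with ω hω1 hω2
    apply propext
    change (_ ∧ raise {v} ω ∈ C) ↔ (_ ∧ ω ∈ C)
    simp only [Set.mem_sdiff, Set.mem_preimage, Set.mem_compl_iff] at hω1 hω2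
    tauto
  -- `P.restrict C` has the same ratios as `P`, so it is `P C • P`; evaluation at `C` gives `P C = P
  -- C * P C`.
  have hQ := eq_smul_geomProduct hφ (ae_restrict_of_ae h.nonneg) hscale
  have := congrArg (fun ρ : Measure (V → ℤ) => ρ C) hQ
  simp only [Measure.restrict_apply_self, Measure.restrict_apply_univ, Measure.smul_apply,
    smul_eq_mul, ← hPdef] at this
  by_cases h0 : P C = 0
  · exact Or.inl h0
  · right
    exact (ENNReal.mul_right_inj h0 (measure_ne_top _ _)).1 (by rw [← this, mul_one])

/-- Ratio one would give `k ≤ ω v` almost surely for every `k`. This yields strict positivity of the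
flow. -/
theorem _root_.ScalesAt.ne_one {P : Measure (V → ℤ)} [IsProbabilityMeasure P] {v : V} {r : ℝ≥0∞}
    (h : ScalesAt P v r) (hP : ∀ᵐ ω ∂P, 0 ≤ ω) : r ≠ 1 := by
  rintro rfl
  have hm : ∀ k : ℕ, MeasurableSet {ω : V → ℤ | (k : ℤ) ≤ ω v} := fun k =>
    measurableSet_le measurable_const (measurable_pi_apply v)
  have hk : ∀ k : ℕ, ∀ᵐ ω ∂P, (k : ℤ) ≤ ω v := by
    intro k
    induction k with
    | zero =>
      filter_upwards [hP] with ω hω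
      exact_mod_cast hω v
    | succ k ih =>
      replace ih := (mem_ae_iff_prob_eq_one (hm k)).1 ih
      refine (mem_ae_iff_prob_eq_one (hm (k + 1))).2 ?_
      have := h.measure_inter (hm (k + 1))
      rw [one_mul] at this
      refine le_antisymm prob_le_one (ih.symm.le.trans (le_trans ?_ (this.symm.le.trans
        (measure_mono Set.inter_subset_left))))
      refine measure_mono fun ω hω => ?_
      simp only [Set.mem_preimage, Set.mem_ofPred_eq, raise_singleton_self] at hω ⊢
      push_cast
      omega
  obtain ⟨ω, hω⟩ := (ae_all_iff.2 hk).exists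
  have := hω (ω v).toNat.succ
  push_cast at this
  omega

theorem exists_geomProduct_eq [Countable V] {P : Measure (V → ℤ)} [IsProbabilityMeasure P]
    (hP : T.IsIncrementGibbs P)
    (htriv : ∀ A, MeasurableSet A → T.IsLocalInvariant A → P A = 0 ∨ P A = 1) :
    ∃ φ : V → ℝ≥0∞, (∀ v, 0 < φ v) ∧ (∀ z, φ z = ∑' v : {v | T.parent v = z}, φ v) ∧
      P = geomProduct φ := by
  choose φ hφ using fun v => exists_geomWeight_one_eq (r := P {ω | 1 ≤ ω v}) prob_le_one
  have hs : ∀ v, ScalesAt P v (geomWeight (φ v) 1) := fun v => by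
    rw [hφ v]
    exact hP.restrict_eq_smul_map_raise htriv v
  have hpos : ∀ v, 0 < φ v := by
    intro v
    refine pos_iff_ne_zero.2 fun h0 => (hs v).ne_one hP.nonneg ?_
    simp [h0, geomWeight]
  refine ⟨φ, hpos, fun z => ?_, ?_⟩
  · apply geomWeight_one_strictAnti.injective
    simp only
    rw [ENNReal.tsum_eq_iSup_sum, geomWeight_one_iSup, hφ z, hP.measure_one_le_eq z]
    have := congrArg (fun ρ : Measure (V → ℤ) => ρ Set.univ)
      (restrict_forall_one_le (fun v => geomWeight_one_le_one (φ v)) hs {v | T.parent v = z})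
    simp only [Measure.restrict_apply_univ, Measure.smul_apply,
      Measure.map_apply (measurable_raise _) .univ, Set.preimage_univ, measure_univ, smul_eq_mul,
      mul_one] at this
    simp only [geomWeight_one_sum]
    exact this
  · have := eq_smul_geomProduct hpos hP.nonneg hs
    rwa [measure_univ, one_smul] at this

theorem geomProduct_injective {ψ : V → ℝ≥0∞} (hφ : ∀ v, 0 < φ v) (hψ : ∀ v, 0 < ψ v)
    (h : geomProduct φ = geomProduct ψ) : φ = ψ := by
  ext v
  apply geomWeight_one_strictAnti.injective
  have h1 := (scalesAt_geomProduct hφ v).measure_inter .univ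
  have h2 := (scalesAt_geomProduct hψ v).measure_inter .univ
  have := isProbabilityMeasure_geomProduct hφ
  have := isProbabilityMeasure_geomProduct hψ
  rw [Set.preimage_univ, measure_univ, mul_one] at h1 h2
  simp only
  rw [← h1, ← h2, h]

end DirectedTree

/-! ### Equivalence of the DLR equations with invariance under partial translations. -/

theorem PreservesShift.setLIntegral_eq {V : Type*} [Countable V] {P : Measure (V → ℤ)} {d : V → ℤ}
    (h : PreservesShift P d) {f : (V → ℤ) → ℝ≥0∞} (hf : Measurable f) :
    ∫⁻ ω in {ω | 0 ≤ ω ∧ 0 ≤ ω + d}, f (ω + d) ∂P = ∫⁻ ω in {ω | 0 ≤ ω ∧ 0 ≤ ω - d}, f ω ∂P := by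
  have hadd : Measurable fun ω : V → ℤ => ω + d := measurable_add_const d
  have hm : (P.restrict {ω | 0 ≤ ω ∧ 0 ≤ ω + d}).map (fun ω => ω + d) =
      P.restrict {ω | 0 ≤ ω ∧ 0 ≤ ω - d} := by
    refine Measure.ext fun E hE => ?_
    rw [Measure.map_apply hadd hE, Measure.restrict_apply (hadd hE), Measure.restrict_apply hE]
    convert h E hE using 2
    · ext ω
      simp only [Set.mem_inter_iff, Set.mem_preimage, Set.mem_ofPred_eq]
      tauto
    · ext ω
      simp only [Set.mem_inter_iff, Set.mem_ofPred_eq]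
      tauto
  rw [← hm, lintegral_map hf hadd]

namespace DirectedTree

variable {V : Type*} (T : DirectedTree V)

/-- The number of changes of the height function in `Λ` that lead to nonnegative increments
in `C`. -/
noncomputable def extensionCount (Λ : Finset V) (C : Set (V → ℤ)) (ω : V → ℤ) : ℝ≥0∞ :=
  ∑' g : Finsupp.supported ℤ ℤ (Λ : Set V),
    (C ∩ {ω | 0 ≤ ω}).indicator 1 (ω + T.increments (g : V →₀ ℤ))

variable {T}

theorem extensionCount_eq_encard (Λ : Finset V) (C : Set (V → ℤ)) (ω : V → ℤ) :
    T.extensionCount Λ C ω = ({g : Finsupp.supported ℤ ℤ (Λ : Set V) |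
      ω + T.increments (g : V →₀ ℤ) ∈ C ∩ {ω | 0 ≤ ω}}.encard : ℝ≥0∞) := by
  rw [← ENNReal.tsum_set_one, tsum_subtype _ fun _ => (1 : ℝ≥0∞)]
  rfl

theorem measurable_extensionCount [Countable V] (Λ : Finset V) {C : Set (V → ℤ)}
    (hC : MeasurableSet C) : Measurable (T.extensionCount Λ C) := by
  refine Measurable.tsum fun g => ?_
  exact (measurable_one.indicator (hC.inter measurableSet_nonneg)).comp (measurable_add_const _)

theorem extensionCount_add {Λ : Finset V} (C : Set (V → ℤ)) (ω : V → ℤ) {g : V →₀ ℤ}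
    (hg : g ∈ Finsupp.supported ℤ ℤ (Λ : Set V)) :
    T.extensionCount Λ C (ω + T.increments g) = T.extensionCount Λ C ω := by
  refine Eq.trans (tsum_congr fun g' => ?_)
    ((Equiv.addLeft (⟨g, hg⟩ : Finsupp.supported ℤ ℤ (Λ : Set V))).tsum_eq fun g' =>
      (C ∩ {ω | 0 ≤ ω}).indicator 1 (ω + T.increments (g' : V →₀ ℤ)))
  simp [add_assoc]

theorem extensionCount_univ_ne_zero (Λ : Finset V) {ω : V → ℤ} (hω : 0 ≤ ω) :
    T.extensionCount Λ Set.univ ω ≠ 0 := by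
  intro h
  have := ENNReal.tsum_eq_zero.1 h 0
  simp [hω] at this

/-- Each vertex of `Λ` has an ancestor and a descendant outside `Λ`, where the height is fixed;
monotonicity bounds its height on both sides. -/
theorem extensionCount_univ_ne_top (Λ : Finset V) (ω : V → ℤ) :
    T.extensionCount Λ Set.univ ω ≠ ∞ := by
  classical
  rw [extensionCount_eq_encard]
  choose k hk using T.exists_iterate_parent_notMem Λ
  choose l y hy hyΛ using T.exists_descendant_notMem Λ
  have hfin : {g : Finsupp.supported ℤ ℤ (Λ : Set V) |
      ω + T.increments (g : V →₀ ℤ) ∈ Set.univ ∩ {ω | 0 ≤ ω}}.Finite := by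
    refine Set.Finite.of_injOn (f := fun (g : Finsupp.supported ℤ ℤ (Λ : Set V)) (v : Λ) =>
        (g : V →₀ ℤ) v)
      (t := Set.Icc (fun v => -T.ancestralSum (l v) (y v) ω) fun v => T.ancestralSum (k v) v ω)
      ?_ ?_ (Set.finite_Icc _ _)
    · rintro ⟨g, hg⟩ ⟨-, hpos⟩
      rw [Finsupp.mem_supported'] at hg
      have hsum : ∀ n x, 0 ≤ T.ancestralSum n x ω + (g (T.parent^[n] x) - g x) := by
        intro n x
        have := T.ancestralSum_nonneg hpos n x
        rw [← T.ancestralSum_increments]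
        refine this.trans (le_of_eq ?_)
        simp only [ancestralSum, Pi.add_apply, Finset.sum_add_distrib]
      refine ⟨fun v => ?_, fun v => ?_⟩
      · have := hsum (l v) (y v)
        rw [hy, hg (y v) (by simpa using hyΛ v)] at this
        simp only
        omega
      · have := hsum (k v) v
        rw [hg _ (by simpa using hk v)] at this
        simp only
        omega
    · rintro ⟨g, hg⟩ - ⟨g', hg'⟩ - h
      rw [Finsupp.mem_supported'] at hg hg'
      refine Subtype.ext (Finsupp.ext fun v => ?_)
      by_cases hv : v ∈ Λ
      · exact congrFun h ⟨v, hv⟩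
      · simp only
        rw [hg v (by simpa using hv), hg' v (by simpa using hv)]
  simpa using hfin

/-- The kernel depends on `b` only through its increments. `C` needs no measurability, since the set
of extensions is countable. -/
theorem localGibbs_preimage_increments [Countable V] (Λ : Finset V) (b : V → ℤ)
    (C : Set (V → ℤ)) : T.localGibbs Λ b (T.increments ⁻¹' C) =
      (T.extensionCount Λ Set.univ (T.increments b))⁻¹ *
        T.extensionCount Λ C (T.increments b) := by
  let f : Finsupp.supported ℤ ℤ (Λ : Set V) → V → ℤ := fun g => b + (g : V →₀ ℤ)
  have hf : Function.Injective f := fun g g' h =>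
    Subtype.ext (DFunLike.coe_injective (add_left_cancel h))
  have hext : ∀ C : Set (V → ℤ), T.extensions Λ b ∩ T.increments ⁻¹' C =
      f '' {g | T.increments b + T.increments (g : V →₀ ℤ) ∈ C ∩ {ω | 0 ≤ ω}} := by
    intro C
    ext h
    simp only [Set.mem_inter_iff, extensions, Set.mem_ofPred_eq, Set.mem_image, Set.mem_preimage,
      T.mem_monotoneFunctions, f]
    constructor
    · rintro ⟨⟨h1, h2⟩, h3⟩
      classical
      have hb : b + (Finsupp.indicator Λ fun x _ => h x - b x : V →₀ ℤ) = h := by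
        ext x
        by_cases hx : x ∈ Λ
        · simp [Finsupp.indicator_of_mem hx]
        · simp [Finsupp.indicator_of_notMem hx, h2 x hx]
      refine ⟨⟨Finsupp.indicator Λ fun x _ => h x - b x, ?_⟩, ?_, hb⟩
      · rw [Finsupp.mem_supported]
        exact_mod_cast Finsupp.support_indicator_subset ..
      · rw [← map_add, hb]
        exact ⟨h3, h1⟩
    · rintro ⟨⟨g, hg⟩, ⟨h1, h2⟩, rfl⟩
      rw [Finsupp.mem_supported'] at hg
      simp only [← map_add] at h1 h2
      refine ⟨⟨h2, fun x hx => ?_⟩, h1⟩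
      simp [hg x (by simpa using hx)]
  have hcount : ∀ C : Set (V → ℤ), Measure.count (T.extensions Λ b ∩ T.increments ⁻¹' C) =
      T.extensionCount Λ C (T.increments b) := by
    intro C
    rw [hext, Measure.count_apply, hf.encard_image, extensionCount_eq_encard]
    exact ((Set.to_countable _).image f).measurableSet
  have hm : MeasurableSet (T.extensions Λ b) := by
    have := hext Set.univ
    rw [Set.preimage_univ, Set.inter_univ] at this
    rw [this]
    exact ((Set.to_countable _).image f).measurableSet
  rw [localGibbs, uniformOn, cond_apply hm, hcount]
  congr 2
  rw [← hcount, Set.preimage_univ, Set.inter_univ]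

variable (T)

/-- The distribution of the increments. -/
noncomputable def incrementLaw (μ : @Measure (V → ℤ) (gradSigma V)) : Measure (V → ℤ) :=
  @Measure.map (V → ℤ) (V → ℤ) (gradSigma V) _ T.increments μ

/-- The measure on the gradient sigma-algebra with a given distribution of the increments. -/
noncomputable def gradMeasure (P : Measure (V → ℤ)) : @Measure (V → ℤ) (gradSigma V) :=
  @Measure.map (V → ℤ) (V → ℤ) _ (gradSigma V) T.height P

variable {T}

theorem incrementLaw_apply (μ : @Measure (V → ℤ) (gradSigma V)) {C : Set (V → ℤ)}
    (hC : MeasurableSet C) : T.incrementLaw μ C = μ (T.increments ⁻¹' C) :=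
  @Measure.map_apply _ _ (gradSigma V) _ μ _ T.measurable_increments _ hC

theorem incrementLaw_gradMeasure (P : Measure (V → ℤ)) : T.incrementLaw (T.gradMeasure P) = P := by
  rw [incrementLaw, gradMeasure, @Measure.map_map _ _ _ _ (gradSigma V) _ _ _ _
    T.measurable_increments T.measurable_height]
  rw [show T.increments ∘ T.height = id from funext T.increments_height, Measure.map_id]

theorem incrementLaw_injective :
    Function.Injective (T.incrementLaw : @Measure (V → ℤ) (gradSigma V) → Measure (V → ℤ)) := by
  intro μ ν h
  refine @Measure.ext _ (gradSigma V) _ _ fun A hA => ?_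
  obtain ⟨C, hC, rfl⟩ := T.exists_preimage_increments hA
  rw [← incrementLaw_apply μ hC, ← incrementLaw_apply ν hC, h]

theorem isProbabilityMeasure_incrementLaw_iff (μ : @Measure (V → ℤ) (gradSigma V)) :
    IsProbabilityMeasure (T.incrementLaw μ) ↔ @IsProbabilityMeasure _ (gradSigma V) μ := by
  constructor
  · intro h
    refine @IsProbabilityMeasure.mk _ (gradSigma V) _ ?_
    have := h.measure_univ
    rwa [incrementLaw_apply μ .univ, Set.preimage_univ] at this
  · intro h
    refine ⟨?_⟩
    rw [incrementLaw_apply μ .univ, Set.preimage_univ]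
    exact @measure_univ _ (gradSigma V) μ h

theorem ae_incrementLaw_iff [Countable V] (μ : @Measure (V → ℤ) (gradSigma V)) :
    (∀ᵐ ω ∂T.incrementLaw μ, 0 ≤ ω) ↔ ∀ᵐ h ∂μ, h ∈ T.monotoneFunctions := by
  simp only [mem_monotoneFunctions]
  exact @ae_map_iff _ _ (gradSigma V) _ μ _ T.measurable_increments.aemeasurable _
    measurableSet_nonneg

theorem lintegral_localGibbs [Countable V] (μ : @Measure (V → ℤ) (gradSigma V)) (Λ : Finset V)
    {C : Set (V → ℤ)} (hC : MeasurableSet C) :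
    ∫⁻ b, T.localGibbs Λ b (T.increments ⁻¹' C) ∂μ = ∫⁻ ω,
      (T.extensionCount Λ Set.univ ω)⁻¹ * T.extensionCount Λ C ω ∂T.incrementLaw μ := by
  simp only [localGibbs_preimage_increments]
  exact (@lintegral_map _ _ (gradSigma V) _ μ _ _
    ((measurable_extensionCount Λ .univ).inv.mul (measurable_extensionCount Λ hC))
    T.measurable_increments).symm

/-- Mass transport: each `ω` spreads its mass evenly over its admissible changes. Translating each
term back by `g` leaves `N` unchanged, and every configuration then receives `N ω` shares of size
`(N ω)⁻¹`. -/
theorem IsIncrementGibbs.lintegral_extensionCount [Countable V] {P : Measure (V → ℤ)}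
    (hP : T.IsIncrementGibbs P) (Λ : Finset V) {C : Set (V → ℤ)} (hC : MeasurableSet C) :
    ∫⁻ ω, (T.extensionCount Λ Set.univ ω)⁻¹ * T.extensionCount Λ C ω ∂P = P C := by
  set N := T.extensionCount Λ Set.univ with hN
  have hNm : Measurable N := measurable_extensionCount Λ .univ
  let f : (V → ℤ) → ℝ≥0∞ := fun ω => (N ω)⁻¹ * C.indicator 1 ω
  have hf : Measurable f := hNm.inv.mul (measurable_one.indicator hC)
  have hS : ∀ d : V → ℤ, MeasurableSet {ω : V → ℤ | 0 ≤ ω ∧ 0 ≤ ω + d} := fun d =>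
    measurableSet_nonneg.inter (measurableSet_add_mem measurableSet_nonneg d)
  have hS' : ∀ d : V → ℤ, MeasurableSet {ω : V → ℤ | 0 ≤ ω ∧ 0 ≤ ω - d} := fun d =>
    measurableSet_nonneg.inter (measurableSet_sub_mem measurableSet_nonneg d)
  calc ∫⁻ ω, (N ω)⁻¹ * T.extensionCount Λ C ω ∂P
      = ∫⁻ ω, ∑' g : Finsupp.supported ℤ ℤ (Λ : Set V),
          {ω | 0 ≤ ω ∧ 0 ≤ ω + T.increments (g : V →₀ ℤ)}.indicator
            (fun ω => f (ω + T.increments (g : V →₀ ℤ))) ω ∂P := by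
        refine lintegral_congr_ae ?_
        filter_upwards [hP.nonneg] with ω hω
        rw [extensionCount, ← ENNReal.tsum_mul_left]
        refine tsum_congr fun g => ?_
        by_cases h : 0 ≤ ω + T.increments (g : V →₀ ℤ)
        · have h' : ω ∈ {ω | 0 ≤ ω ∧ 0 ≤ ω + T.increments (g : V →₀ ℤ)} := ⟨hω, h⟩
          rw [Set.indicator_of_mem h']
          simp only [f, hN, extensionCount_add _ _ g.2]
          by_cases hc : ω + T.increments (g : V →₀ ℤ) ∈ C
          · have hc' : ω + T.increments (g : V →₀ ℤ) ∈ C ∩ {ω | 0 ≤ ω} := ⟨hc, h⟩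
            rw [Set.indicator_of_mem hc, Set.indicator_of_mem hc']
          · rw [Set.indicator_of_notMem hc, Set.indicator_of_notMem fun h => hc h.1]
        · rw [Set.indicator_of_notMem fun h' => h h'.2,
            Set.indicator_of_notMem fun h' => h h'.2, mul_zero]
    _ = ∑' g : Finsupp.supported ℤ ℤ (Λ : Set V), ∫⁻ ω,
          {ω | 0 ≤ ω ∧ 0 ≤ ω + T.increments (g : V →₀ ℤ)}.indicator
            (fun ω => f (ω + T.increments (g : V →₀ ℤ))) ω ∂P :=
        lintegral_tsum fun g =>
          ((hf.comp (measurable_add_const _)).indicator (hS _)).aemeasurable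
    _ = ∑' g : Finsupp.supported ℤ ℤ (Λ : Set V), ∫⁻ ω,
          {ω | 0 ≤ ω ∧ 0 ≤ ω - T.increments (g : V →₀ ℤ)}.indicator f ω ∂P := by
        refine tsum_congr fun g => ?_
        rw [lintegral_indicator (hS _), lintegral_indicator (hS' _)]
        exact (hP.preservesShift g).setLIntegral_eq hf
    _ = ∫⁻ ω, ∑' g : Finsupp.supported ℤ ℤ (Λ : Set V),
          {ω | 0 ≤ ω ∧ 0 ≤ ω - T.increments (g : V →₀ ℤ)}.indicator f ω ∂P :=
        (lintegral_tsum fun g => (hf.indicator (hS' _)).aemeasurable).symm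
    _ = ∫⁻ ω, C.indicator 1 ω ∂P := by
        refine lintegral_congr_ae ?_
        filter_upwards [hP.nonneg] with ω hω
        have : ∀ g : Finsupp.supported ℤ ℤ (Λ : Set V),
            {ω | 0 ≤ ω ∧ 0 ≤ ω - T.increments (g : V →₀ ℤ)}.indicator f ω = f ω *
              (Set.univ ∩ {ω | 0 ≤ ω}).indicator 1
                (ω + T.increments ((-g : Finsupp.supported ℤ ℤ (Λ : Set V)) : V →₀ ℤ)) := by
          intro g
          rw [Submodule.coe_neg, Finsupp.coe_neg, map_neg, ← sub_eq_add_neg]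
          by_cases h : 0 ≤ ω - T.increments (g : V →₀ ℤ)
          · have h' : ω ∈ {ω | 0 ≤ ω ∧ 0 ≤ ω - T.increments (g : V →₀ ℤ)} := ⟨hω, h⟩
            have h'' : ω - T.increments (g : V →₀ ℤ) ∈ Set.univ ∩ {ω | 0 ≤ ω} := ⟨trivial, h⟩
            rw [Set.indicator_of_mem h', Set.indicator_of_mem h'', Pi.one_apply, mul_one]
          · rw [Set.indicator_of_notMem fun h' => h h'.2,
              Set.indicator_of_notMem fun h' => h h'.2, mul_zero]
        have hneg : ∑' g : Finsupp.supported ℤ ℤ (Λ : Set V), (Set.univ ∩ {ω | 0 ≤ ω}).indicator 1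
            (ω + T.increments ((-g : Finsupp.supported ℤ ℤ (Λ : Set V)) : V →₀ ℤ)) = N ω :=
          (Equiv.neg (Finsupp.supported ℤ ℤ (Λ : Set V))).tsum_eq fun g =>
            (Set.univ ∩ {ω | 0 ≤ ω}).indicator 1 (ω + T.increments (g : V →₀ ℤ))
        simp only [this]
        rw [ENNReal.tsum_mul_left, hneg]
        change (N ω)⁻¹ * C.indicator 1 ω * N ω = _
        rw [mul_right_comm, ENNReal.inv_mul_cancel (extensionCount_univ_ne_zero Λ hω)
          (extensionCount_univ_ne_top Λ ω), one_mul]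
    _ = P C := lintegral_indicator_one hC

theorem isGradientGibbs_iff [Countable V] (μ : @Measure (V → ℤ) (gradSigma V)) :
    T.IsGradientGibbs μ ↔
      IsProbabilityMeasure (T.incrementLaw μ) ∧ T.IsIncrementGibbs (T.incrementLaw μ) := by
  rw [isProbabilityMeasure_incrementLaw_iff]
  constructor
  · intro h
    refine ⟨h.isProbabilityMeasure, (ae_incrementLaw_iff μ).2 h.supported, fun g E hE => ?_⟩
    set d := T.increments g
    have hm1 : MeasurableSet {ω : V → ℤ | 0 ≤ ω ∧ 0 ≤ ω + d ∧ ω + d ∈ E} :=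
      measurableSet_nonneg.inter ((measurableSet_add_mem measurableSet_nonneg d).inter
        (measurableSet_add_mem hE d))
    have hm2 : MeasurableSet {ω : V → ℤ | 0 ≤ ω ∧ 0 ≤ ω - d ∧ ω ∈ E} :=
      measurableSet_nonneg.inter ((measurableSet_sub_mem measurableSet_nonneg d).inter hE)
    rw [incrementLaw_apply μ hm1, incrementLaw_apply μ hm2,
      ← h.dlr g.support _ (T.measurable_increments hm1),
      ← h.dlr g.support _ (T.measurable_increments hm2)]
    refine lintegral_congr fun b => ?_
    rw [localGibbs_preimage_increments, localGibbs_preimage_increments]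
    congr 1
    have hg : g ∈ Finsupp.supported ℤ ℤ (g.support : Set V) := by simp [Finsupp.mem_supported]
    -- With `Λ = g.support`, the substitution `g' ↦ g' + g` matches the configurations counted on
    -- the two sides, so the kernels agree for every `b`.
    refine Eq.trans ?_ ((Equiv.addRight (⟨g, hg⟩ :
      Finsupp.supported ℤ ℤ (g.support : Set V))).tsum_eq fun g' =>
        ({ω : V → ℤ | 0 ≤ ω ∧ 0 ≤ ω - d ∧ ω ∈ E} ∩ {ω | 0 ≤ ω}).indicator (1 : (V → ℤ) → ℝ≥0∞)
          (T.increments b + T.increments (g' : V →₀ ℤ)))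
    refine tsum_congr fun g' => ?_
    have hadd : T.increments b + T.increments (((g' + ⟨g, hg⟩ :
        Finsupp.supported ℤ ℤ (g.support : Set V)) : V →₀ ℤ)) =
          T.increments b + T.increments (g' : V →₀ ℤ) + d := by
      simp [d, add_assoc]
    rw [Equiv.coe_addRight, hadd]
    set ω := T.increments b + T.increments (g' : V →₀ ℤ)
    have hiff : ω ∈ {ω : V → ℤ | 0 ≤ ω ∧ 0 ≤ ω + d ∧ ω + d ∈ E} ∩ {ω | 0 ≤ ω} ↔
        ω + d ∈ {ω : V → ℤ | 0 ≤ ω ∧ 0 ≤ ω - d ∧ ω ∈ E} ∩ {ω | 0 ≤ ω} := by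
      simp only [Set.mem_inter_iff, Set.mem_ofPred_eq, add_sub_cancel_right]
      tauto
    by_cases hω : ω + d ∈ {ω : V → ℤ | 0 ≤ ω ∧ 0 ≤ ω - d ∧ ω ∈ E} ∩ {ω | 0 ≤ ω}
    · rw [Set.indicator_of_mem hω, Set.indicator_of_mem (hiff.2 hω)]
      rfl
    · rw [Set.indicator_of_notMem hω, Set.indicator_of_notMem (mt hiff.1 hω)]
  · rintro ⟨h1, h2⟩
    refine ⟨h1, (ae_incrementLaw_iff μ).1 h2.nonneg, fun Λ A hA => ?_⟩
    obtain ⟨C, hC, rfl⟩ := T.exists_preimage_increments hA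
    rw [lintegral_localGibbs μ Λ hC, h2.lintegral_extensionCount Λ hC, incrementLaw_apply μ hC]

end DirectedTree

/-! ### Tail events as local-invariant sets. -/

theorem measurable_eval_outsideSigma {V : Type*} {Λ : Finset V} {x : V} (hx : x ∉ Λ) :
    Measurable[outsideSigma Λ] fun h : V → ℤ => h x := by
  rw [measurable_iff_comap_le]
  exact le_iSup₂_of_le x hx le_rfl

theorem mem_iff_of_measurableSet_outsideSigma {V : Type*} {Λ : Finset V} {A : Set (V → ℤ)}
    (hA : MeasurableSet[outsideSigma Λ] A) {h h' : V → ℤ} (hh : ∀ x, x ∉ Λ → h x = h' x) :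
    h ∈ A ↔ h' ∈ A := by
  have hle : outsideSigma Λ ≤
      MeasurableSpace.comap (fun (h : V → ℤ) (x : {x // x ∉ Λ}) => h x) ⊤ := by
    refine iSup₂_le fun x hx => ?_
    rw [show (fun h : V → ℤ => h x) =
      (fun f : {x // x ∉ Λ} → ℤ => f ⟨x, hx⟩) ∘ fun (h : V → ℤ) (x : {x // x ∉ Λ}) => h x from rfl,
      ← MeasurableSpace.comap_comp]
    exact MeasurableSpace.comap_mono le_top
  obtain ⟨B, -, rfl⟩ := hle _ hA
  have : (fun x : {x // x ∉ Λ} => h x) = fun x : {x // x ∉ Λ} => h' x :=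
    funext fun x => hh x x.2
  simp only [Set.mem_preimage, this]

namespace DirectedTree

variable {V : Type*} {T : DirectedTree V}

theorem gradSigma_le_pi : gradSigma V ≤ MeasurableSpace.pi :=
  iSup₂_le fun x y => ((measurable_pi_apply y).sub (measurable_pi_apply x)).comap_le

/-- An event determined outside `g.support` ignores the addition of `g`. Conversely, an invariant
event is unchanged when the heights in `Λ` are reset to zero, so it is determined outside `Λ`. -/
theorem measurableSet_gradTailSigma_iff [Countable V] {C : Set (V → ℤ)} (hC : MeasurableSet C) :
    MeasurableSet[gradTailSigma V] (T.increments ⁻¹' C) ↔ T.IsLocalInvariant C := by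
  classical
  have hCg := T.measurable_increments hC
  refine (MeasurableSpace.measurableSet_inf.trans
    (and_congr MeasurableSpace.measurableSet_iInf Iff.rfl)).trans ?_
  constructor
  · rintro ⟨h, -⟩ g ω
    have := mem_iff_of_measurableSet_outsideSigma (h g.support) (h := T.height ω + g)
      (h' := T.height ω) fun x hx => by simp [Finsupp.notMem_support_iff.1 hx]
    rwa [Set.mem_preimage, Set.mem_preimage, map_add, T.increments_height] at this
  · refine fun h => ⟨fun Λ => ?_, hCg⟩
    let f : (V → ℤ) → V → ℤ := fun h x => if x ∈ Λ then 0 else h x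
    have hf : Measurable[outsideSigma Λ] f := by
      refine @measurable_pi_lambda _ _ _ (outsideSigma Λ) _ _ fun x => ?_
      by_cases hx : x ∈ Λ
      · simp only [f, if_pos hx]
        exact @measurable_const _ _ _ (outsideSigma Λ) _
      · simp only [f, if_neg hx]
        exact measurable_eval_outsideSigma hx
    have hpre : T.increments ⁻¹' C = f ⁻¹' (T.increments ⁻¹' C) := by
      ext b
      have hb : b = f b + (Finsupp.indicator Λ fun x _ => b x : V →₀ ℤ) := by
        ext x
        by_cases hx : x ∈ Λ
        · simp [f, hx]
        · simp [f, hx]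
      rw [Set.mem_preimage, Set.mem_preimage, Set.mem_preimage, 
        ← h (Finsupp.indicator Λ fun x _ => b x) (T.increments (f b)), ← map_add, ← hb]
    rw [hpre]
    exact hf (gradSigma_le_pi _ hCg)

theorem isExtremalGradientGibbs_iff [Countable V] (μ : @Measure (V → ℤ) (gradSigma V)) :
    T.IsExtremalGradientGibbs μ ↔
      IsProbabilityMeasure (T.incrementLaw μ) ∧ T.IsIncrementGibbs (T.incrementLaw μ) ∧
        ∀ C, MeasurableSet C → T.IsLocalInvariant C →
          T.incrementLaw μ C = 0 ∨ T.incrementLaw μ C = 1 := by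
  rw [← and_assoc, ← isGradientGibbs_iff]
  constructor
  · rintro ⟨h1, h2⟩
    refine ⟨h1, fun C hC hinv => ?_⟩
    rw [incrementLaw_apply μ hC]
    exact h2 _ ((measurableSet_gradTailSigma_iff hC).2 hinv)
  · rintro ⟨h1, h2⟩
    refine ⟨h1, fun A hA => ?_⟩
    obtain ⟨C, hC, rfl⟩ := T.exists_preimage_increments
      ((MeasurableSpace.measurableSet_inf.1 hA).2)
    rw [← incrementLaw_apply μ hC]
    exact h2 C hC ((measurableSet_gradTailSigma_iff hC).1 hA)

/-! ### From edges to child vertices, and the main theorem. -/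

theorem parentEdge_surjective : Function.Surjective T.parentEdge := by
  rintro ⟨⟨x, y⟩, h⟩
  have h' : y = T.parent x := T.arc_iff.1 h
  subst h'
  exact ⟨x, rfl⟩

theorem edge_fst_injective : Function.Injective fun e : T.Edge => e.1.1 := by
  intro e e' h
  obtain ⟨x, rfl⟩ := parentEdge_surjective e
  obtain ⟨x', rfl⟩ := parentEdge_surjective e'
  exact congrArg _ h

theorem isFlowMeasure_iff [Countable V] {φ : T.Edge → ℝ≥0∞} (hφ : ∀ e, 0 < φ e)
    (μ : @Measure (V → ℤ) (gradSigma V)) :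
    T.IsFlowMeasure φ μ ↔ T.incrementLaw μ = geomProduct fun v => φ (T.parentEdge v) := by
  have hmeas : ∀ v, Measurable[gradSigma V] fun h : V → ℤ => T.increments h v := fun v =>
    (measurable_pi_apply v).comp T.measurable_increments
  have hlaw : ∀ v, @Measure.map _ _ (gradSigma V) _ (fun h => T.increments h v) μ =
      (T.incrementLaw μ).map fun ω => ω v := fun v =>
    (@Measure.map_map _ _ _ (gradSigma V) _ _ _ _ _ (measurable_pi_apply v)
      T.measurable_increments).symm
  constructor
  · rintro ⟨hp, hind, hl⟩
    have hind' := hind.precomp (g := T.parentEdge) fun x y h => congrArg (fun e => e.1.1) h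
    have := (iIndepFun_iff_map_fun_eq_infinitePi_map (P := μ) hmeas).1 hind'
    refine this.trans ?_
    rw [geomProduct]
    congr 1
    exact funext fun v => hl (T.parentEdge v)
  · intro h
    have hpr : IsProbabilityMeasure (T.incrementLaw μ) := by
      rw [h]
      exact isProbabilityMeasure_geomProduct fun v => hφ _
    have hp := (isProbabilityMeasure_incrementLaw_iff μ).1 hpr
    have hl : ∀ v, @Measure.map _ _ (gradSigma V) _ (fun h => T.increments h v) μ =
        geomDist (φ (T.parentEdge v)) := fun v => by
      rw [hlaw, h]
      exact map_eval_geomProduct (fun v => hφ (T.parentEdge v)) v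
    have hind := (iIndepFun_iff_map_fun_eq_infinitePi_map (P := μ) hmeas).2
      (by simp only [hl]; exact h)
    refine ⟨hp, ?_, fun e => ?_⟩
    · convert hind.precomp edge_fst_injective using 2 with e
      obtain ⟨x, rfl⟩ := parentEdge_surjective e
      rfl
    · obtain ⟨x, rfl⟩ := parentEdge_surjective e
      exact hl x

theorem isFlow_iff (φ : T.Edge → ℝ≥0∞) : T.IsFlow φ ↔
    (∀ v, 0 < φ (T.parentEdge v)) ∧ ∀ z, φ (T.parentEdge z) =
      ∑' v : {v | T.parent v = z}, φ (T.parentEdge v) := by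
  have hsum : ∀ z, ∑' y, φ (T.childEdge z y) =
      ∑' v : {v | T.parent v = z}, φ (T.parentEdge v) := by
    intro z
    have he : ∀ y, T.Arc y z ↔ y ∈ {v | T.parent v = z} := fun y => T.arc_iff.trans eq_comm
    rw [← (Equiv.subtypeEquivRight he).tsum_eq fun v : {v | T.parent v = z} =>
      φ (T.parentEdge v)]
    refine tsum_congr fun y => congrArg φ (Subtype.ext (Prod.ext rfl ?_))
    exact T.arc_iff.1 y.2
  constructor
  · rintro ⟨h1, h2⟩
    exact ⟨fun v => h1 _, fun z => (h2 z).trans (hsum z)⟩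
  · rintro ⟨h1, h2⟩
    refine ⟨fun e => ?_, fun z => (h2 z).trans (hsum z).symm⟩
    obtain ⟨x, rfl⟩ := parentEdge_surjective e
    exact h1 x

theorem isExtremalGradientGibbs_gradMeasure [Countable V] {φ : V → ℝ≥0∞} (hφ : ∀ v, 0 < φ v)
    (h : ∀ z, φ z = ∑' v : {v | T.parent v = z}, φ v) :
    T.IsExtremalGradientGibbs (T.gradMeasure (geomProduct φ)) := by
  have hG := isIncrementGibbs_geomProduct hφ h
  rw [isExtremalGradientGibbs_iff, incrementLaw_gradMeasure]
  exact ⟨isProbabilityMeasure_geomProduct hφ, hG, fun C hC => geomProduct_eq_zero_or_one hφ hG hC⟩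

end DirectedTree

/-- The final equivalence carries both existence and uniqueness of `μ_φ`, and identifies `M φ` with
it. -/
theorem theorem2p9 {V : Type*} [Countable V] (T : DirectedTree V) :
    ∃ M : T.Flow → T.ExtremalGradientGibbs,
      Function.Bijective M ∧
      ∀ (φ : T.Flow) (μ : @MeasureTheory.Measure (V → ℤ) (gradSigma V)),
        T.IsFlowMeasure φ.1 μ ↔ μ = (M φ).1 := by
  have hflow := fun φ : T.Flow => (T.isFlow_iff φ.1).1 φ.2
  refine ⟨fun φ => ⟨T.gradMeasure (geomProduct fun v => φ.1 (T.parentEdge v)),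
    T.isExtremalGradientGibbs_gradMeasure (hflow φ).1 (hflow φ).2⟩, ⟨?_, ?_⟩, ?_⟩
  · intro φ ψ h
    have h' := congrArg T.incrementLaw (congrArg Subtype.val h)
    simp only [DirectedTree.incrementLaw_gradMeasure] at h'
    have := DirectedTree.geomProduct_injective (hflow φ).1 (hflow ψ).1 h'
    refine Subtype.ext (funext fun e => ?_)
    obtain ⟨x, rfl⟩ := DirectedTree.parentEdge_surjective e
    exact congrFun this x
  · rintro ⟨μ, hμ⟩
    obtain ⟨hp, hG, htriv⟩ := (DirectedTree.isExtremalGradientGibbs_iff μ).1 hμ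
    obtain ⟨φ, hpos, hcons, hφ⟩ := DirectedTree.exists_geomProduct_eq hG htriv
    refine ⟨⟨fun e => φ e.1.1, (T.isFlow_iff _).2 ⟨hpos, hcons⟩⟩, Subtype.ext ?_⟩
    apply DirectedTree.incrementLaw_injective (T := T)
    rw [DirectedTree.incrementLaw_gradMeasure, hφ]
    rfl
  · intro φ μ
    rw [DirectedTree.isFlowMeasure_iff φ.2.pos,
      ← (DirectedTree.incrementLaw_injective (T := T)).eq_iff, DirectedTree.incrementLaw_gradMeasure]
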